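/- Let $(\mathcal M,\mathcal F)$ be a connected smooth manifold with a transversally holomorphic foliation of complex codimension $n$, that is, given by an open cover $\{U_i\}$, smooth submersions $\varphi_i:U_i\to T$ to a complex $n$-dimensional manifold $T$, and local biholomorphisms $f_{ij}$ of $T$ with $\varphi_j=f_{ij}\circ\varphi_i$ on $U_i\cap U_j$. Forms are complex valued. A smooth form $\varphi$ is basic if $i_X\varphi=\mathcal L_X\varphi=0$ for all $X$ tangent to the leaves; $\Omega^k(\mathcal M/\mathcal F)$ denotes the basic $k$-forms and $\Omega^{p,q}(\mathcal M/\mathcal F)$ those of type $(p,q)$ for the complex structure of the normal bundle. Let $\omega$ be the fundamental form of a transverse Hermitian metric $g$ invariant along the leaves (a real basic $(1,1)$-form, positive on the normal bundle), and suppose that $(\mathcal M,\mathcal F,\omega,\theta)$ is a transversally locally conformally Kähler foliation with Lee form $\theta$: every point has an open neighbourhood $U$ with a smooth basic function $\sigma:U\to\mathbb R$ such that $e^{-\sigma}g$ is a transverse Kähler metric on $U$ (i.e. $d(e^{-\sigma}\omega)=0$) and $\theta|_U=d\sigma$. Let $E$ be the weight bundle, i.e. the trivial complex foliated line bundle with the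 flat basic connection $\nabla_b=d_b-\theta\wedge$, so that $E$-valued basic forms are basic forms, and let $\partial_{b,E}:\Omega^{p,q}\to\Omega^{p+1,q}$ and $\overline\partial_{b,E}:\Omega^{p,q}\to\Omega^{p,q+1}$ be the $(1,0)$- and $(0,1)$-parts of $\nabla_b$. Put: - $H^k_\theta(\mathcal M/\mathcal F)$, the basic Lichnerowicz cohomology: the cohomology of $(\Omega^\bullet(\mathcal M/\mathcal F),\,d_b-\theta\wedge)$; - $H^k(\mathcal M/\mathcal F,\mathcal E)$, the holomorphic basic cohomology of the holomorphic bundle $\mathcal E$ underlying $E$: the cohomology of $(\Omega^{0,\bullet}(\mathcal M/\mathcal F),\,\overline\partial_{b,E})$; - $H^{1,1}_{BC}(\mathcal M/\mathcal F,E)=\dfrac{\{\varphi\in\Omega^{1,1}(\mathcal M/\mathcal F):\partial_{b,E}\varphi=0,\ \overline\partial_{b,E}\varphi=0\}}{\partial_{b,E}\overline\partial_{b,E}\,\Omega^{0,0}(\mathcal M/\mathcal F)}$, the basic Bott–Chern group with coefficients in $E$. If $H^1(\mathcal M/\mathcal F,\mathcal E)=0$ and $H^2_\theta(\mathcal M/\mathcal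 F)=0$, then $H^{1,1}_{BC}(\mathcal M/\mathcal F,E)=0$. -/

import Mathlib

open scoped Manifold ContDiff Topology

noncomputable section

namespace TransLCK

/-! ### Pointwise multilinear algebra -/

section Pointwise

variable {V : Type*} [NormedAddCommGroup V] [NormedSpace ℝ V] {k : ℕ}

/-- The wedge product `β ∧ α` of a `1`-form with a `k`-form, both complex valued:
`(β ∧ α)(v₀, …, v_k) = ∑ i, (-1)^i β(v_i) α(v₀, …, v̂_i, …, v_k)`
(the normalisation used by Mathlib for the exterior derivative). -/
def wedgeOne (β : V [⋀^Fin 1]→L[ℝ] ℂ) (α : V [⋀^Fin k]→L[ℝ] ℂ) :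
    V [⋀^Fin (k + 1)]→L[ℝ] ℂ :=
  ContinuousAlternatingMap.alternatizeUncurryFin
    (((ContinuousAlternatingMap.ofSubsingleton ℝ V ℂ (0 : Fin 1)).symm β).smulRight α)

theorem wedgeOne_apply (β : V [⋀^Fin 1]→L[ℝ] ℂ) (α : V [⋀^Fin k]→L[ℝ] ℂ) (v : Fin (k + 1) → V) :
    wedgeOne β α v = ∑ i : Fin (k + 1), (-1) ^ (i : ℕ) • (β (fun _ => v i) * α (i.removeNth v)) := by
  simp [wedgeOne, ContinuousAlternatingMap.alternatizeUncurryFin_apply]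

theorem wedgeOne_add (β : V [⋀^Fin 1]→L[ℝ] ℂ) (α α' : V [⋀^Fin k]→L[ℝ] ℂ) :
    wedgeOne β (α + α') = wedgeOne β α + wedgeOne β α' := by
  ext v
  simp [wedgeOne_apply, mul_add, Finset.sum_add_distrib]

theorem wedgeOne_smul (β : V [⋀^Fin 1]→L[ℝ] ℂ) (c : ℂ) (α : V [⋀^Fin k]→L[ℝ] ℂ) :
    wedgeOne β (c • α) = c • wedgeOne β α := by
  ext v
  simp only [wedgeOne_apply, ContinuousAlternatingMap.smul_apply, smul_eq_mul, Finset.mul_sum]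
  refine Finset.sum_congr rfl fun i _ => ?_
  simp only [zsmul_eq_mul]
  ring

/-- The value `α(v₁^{ε₁}, …, v_k^{ε_k})` of the complex multilinear extension of `α`, where
`v_r^{ε_r}` is the `(1,0)`-part `(v_r - i J v_r)/2` of `v_r` if `r ∈ S`, and its `(0,1)`-part
`(v_r + i J v_r)/2` if `r ∉ S`.  The expression is expanded by multilinearity:
`R` is the set of slots in which the summand `∓ i J v_r / 2` is taken. -/
def slotEval (J : V →L[ℝ] V) (S : Finset (Fin k)) (α : V [⋀^Fin k]→L[ℝ] ℂ) (v : Fin k → V) : ℂ :=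
  (1 / 2 : ℂ) ^ k * ∑ R : Finset (Fin k),
    (∏ r ∈ R, if r ∈ S then -Complex.I else Complex.I) *
      α (fun r => if r ∈ R then J (v r) else v r)

/-- The underlying continuous multilinear map of `slotEval`. -/
def slotMap (J : V →L[ℝ] V) (S : Finset (Fin k)) (α : V [⋀^Fin k]→L[ℝ] ℂ) :
    ContinuousMultilinearMap ℝ (fun _ : Fin k => V) ℂ :=
  (1 / 2 : ℂ) ^ k • ∑ R : Finset (Fin k),
    (∏ r ∈ R, if r ∈ S then -Complex.I else Complex.I) •
      α.toContinuousMultilinearMap.compContinuousLinearMap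
        (fun r => if r ∈ R then J else ContinuousLinearMap.id ℝ V)

theorem slotMap_apply (J : V →L[ℝ] V) (S : Finset (Fin k)) (α : V [⋀^Fin k]→L[ℝ] ℂ)
    (v : Fin k → V) : slotMap J S α v = slotEval J S α v := by
  simp only [slotMap, slotEval, smul_apply,
    sum_apply, ContinuousMultilinearMap.compContinuousLinearMap_apply,
    smul_eq_mul]
  congr 1
  refine Finset.sum_congr rfl fun R _ => ?_
  congr 1
  show α _ = α _
  congr 1
  funext r
  split_ifs <;> rfl

theorem slotEval_swap (J : V →L[ℝ] V) (S : Finset (Fin k)) (α : V [⋀^Fin k]→L[ℝ] ℂ)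
    (v : Fin k → V) {i j : Fin k} (hij : i ≠ j) (hv : v i = v j) :
    slotEval J ((Equiv.swap i j).finsetCongr S) α v = -slotEval J S α v := by
  have hvs : ∀ r, v (Equiv.swap i j r) = v r := by
    intro r
    rw [Equiv.swap_apply_def]
    split_ifs with h1 h2
    · rw [h1, hv]
    · rw [h2, hv]
    · rfl
  unfold slotEval
  rw [← mul_neg, ← Finset.sum_neg_distrib]
  congr 1
  rw [← Equiv.sum_comp (Equiv.swap i j).finsetCongr]
  refine Finset.sum_congr rfl fun R _ => ?_
  rw [← mul_neg]
  congr 1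
  · simp [Equiv.finsetCongr_apply, Finset.prod_map]
  · have h := α.toAlternatingMap.map_swap (fun r => if r ∈ R then J (v r) else v r) hij
    have h' : α ((fun r => if r ∈ R then J (v r) else v r) ∘ Equiv.swap i j) =
        -α (fun r => if r ∈ R then J (v r) else v r) := h
    rw [← h']
    congr 1
    funext r
    have hmem : r ∈ (Equiv.swap i j).finsetCongr R ↔ Equiv.swap i j r ∈ R := by
      simp only [Equiv.finsetCongr_apply, Finset.mem_map_equiv, Equiv.symm_swap]
    simp only [Function.comp_apply, hmem, hvs]

/-- The component of type `(p,q)` of a complex valued `k`-form `α` with respect to `J`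
(it vanishes unless `p + q = k`): the sum, over all choices of `p` slots in which the `(1,0)`-part
of the argument is inserted, the `(0,1)`-part being inserted in the remaining `q` slots, of the
complex multilinear extension of `α`. -/
def hodgePart (J : V →L[ℝ] V) (p q : ℕ) :
    (V [⋀^Fin k]→L[ℝ] ℂ) →ₗ[ℂ] (V [⋀^Fin k]→L[ℝ] ℂ) where
  toFun α :=
    { toContinuousMultilinearMap :=
        ∑ S : Finset (Fin k), if S.card = p ∧ Sᶜ.card = q then slotMap J S α else 0
      map_eq_zero_of_eq' := by
        intro v i j hv hij
        have key : ∀ w : Fin k → V, (∑ S : Finset (Fin k),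
            if S.card = p ∧ Sᶜ.card = q then slotMap J S α else 0) w =
            ∑ S : Finset (Fin k), if S.card = p ∧ Sᶜ.card = q then slotEval J S α w else 0 := by
          intro w
          rw [sum_apply]
          refine Finset.sum_congr rfl fun S _ => ?_
          split_ifs
          · exact slotMap_apply J S α w
          · rfl
        show (∑ S : Finset (Fin k),
            if S.card = p ∧ Sᶜ.card = q then slotMap J S α else 0) v = 0
        rw [key]
        have hneg : (∑ S : Finset (Fin k),
            if S.card = p ∧ Sᶜ.card = q then slotEval J S α v else 0) =
            -∑ S : Finset (Fin k),
            if S.card = p ∧ Sᶜ.card = q then slotEval J S α v else 0 := by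
          conv_lhs => rw [← Equiv.sum_comp (Equiv.swap i j).finsetCongr]
          rw [← Finset.sum_neg_distrib]
          refine Finset.sum_congr rfl fun S _ => ?_
          rw [slotEval_swap J S α v hij hv]
          simp only [Equiv.finsetCongr_apply, Finset.card_map, Finset.card_compl]
          split_ifs <;> simp
        exact self_eq_neg.mp hneg }
  map_add' α β := by
    ext v
    show (∑ S : Finset (Fin k), if S.card = p ∧ Sᶜ.card = q then slotMap J S (α + β) else 0) v =
      (∑ S : Finset (Fin k), if S.card = p ∧ Sᶜ.card = q then slotMap J S α else 0) v +
      (∑ S : Finset (Fin k), if S.card = p ∧ Sᶜ.card = q then slotMap J S β else 0) v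
    simp only [sum_apply]
    rw [← Finset.sum_add_distrib]
    refine Finset.sum_congr rfl fun S _ => ?_
    split_ifs
    · simp [slotMap_apply, slotEval, mul_add, Finset.sum_add_distrib]
    · simp
  map_smul' c α := by
    ext v
    show (∑ S : Finset (Fin k), if S.card = p ∧ Sᶜ.card = q then slotMap J S (c • α) else 0) v =
      c • (∑ S : Finset (Fin k), if S.card = p ∧ Sᶜ.card = q then slotMap J S α else 0) v
    simp only [sum_apply]
    rw [Finset.smul_sum]
    refine Finset.sum_congr rfl fun S _ => ?_
    split_ifs
    · simp only [slotMap_apply, slotEval, ContinuousAlternatingMap.smul_apply, smul_eq_mul,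
        Finset.mul_sum]
      refine Finset.sum_congr rfl fun R _ => ?_
      ring
    · simp

theorem hodgePart_apply (J : V →L[ℝ] V) (p q : ℕ) (α : V [⋀^Fin k]→L[ℝ] ℂ) (v : Fin k → V) :
    hodgePart J p q α v =
      ∑ S : Finset (Fin k), if S.card = p ∧ Sᶜ.card = q then slotEval J S α v else 0 := by
  show (∑ S : Finset (Fin k), if S.card = p ∧ Sᶜ.card = q then slotMap J S α else 0) v = _
  rw [sum_apply]
  refine Finset.sum_congr rfl fun S _ => ?_
  split_ifs
  · exact slotMap_apply J S α v
  · rfl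

end Pointwise

/-! ### Complex valued differential forms on a manifold -/

section Forms

variable {E : Type*} [NormedAddCommGroup E] [NormedSpace ℝ E]
  {M : Type*} [TopologicalSpace M] [ChartedSpace E M]

variable (E M) in
/-- Complex valued `k`-forms on `M`, without regularity.  The tangent space `T_xM`, which is
`TangentSpace 𝓘(ℝ, E) x` in Mathlib, is by definition a copy of `E` (identified through the
chart at `x`). -/
def Form (k : ℕ) : Type _ :=
  M → E [⋀^Fin k]→L[ℝ] ℂ

instance (k : ℕ) : AddCommGroup (Form E M k) :=
  inferInstanceAs (AddCommGroup (M → E [⋀^Fin k]→L[ℝ] ℂ))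

instance (k : ℕ) : Module ℂ (Form E M k) :=
  inferInstanceAs (Module ℂ (M → E [⋀^Fin k]→L[ℝ] ℂ))

/-- The local expression of a form in the chart at `x₀`, i.e. its pull-back to (an open subset of)
`E` by the inverse of the chart. -/
def localRep {k : ℕ} (φ : Form E M k) (x₀ : M) (y : E) : E [⋀^Fin k]→L[ℝ] ℂ :=
  (φ ((extChartAt 𝓘(ℝ, E) x₀).symm y)).compContinuousLinearMap
    (mfderiv 𝓘(ℝ, E) 𝓘(ℝ, E) (extChartAt 𝓘(ℝ, E) x₀).symm y)

/-- A form is smooth if all its local expressions are. -/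
def IsSmoothForm {k : ℕ} (φ : Form E M k) : Prop :=
  ∀ x₀ : M, ContDiffOn ℝ ∞ (localRep φ x₀) (extChartAt 𝓘(ℝ, E) x₀).target

/-- The exterior derivative, computed at `x` in the chart at `x`. -/
def extD {k : ℕ} (φ : Form E M k) : Form E M (k + 1) := fun x =>
  (extDeriv (localRep φ x) (extChartAt 𝓘(ℝ, E) x x)).compContinuousLinearMap
    (mfderiv 𝓘(ℝ, E) 𝓘(ℝ, E) (extChartAt 𝓘(ℝ, E) x) x)

/-- The operator `d_θ = d - θ ∧`. -/
def lichD (θ : Form E M 1) {k : ℕ} (φ : Form E M k) : Form E M (k + 1) := fun x =>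
  extD φ x - wedgeOne (θ x) (φ x)

theorem localRep_add {k : ℕ} (φ ψ : Form E M k) (x₀ : M) :
    localRep (φ + ψ) x₀ = localRep φ x₀ + localRep ψ x₀ := rfl

theorem localRep_smul {k : ℕ} (c : ℂ) (φ : Form E M k) (x₀ : M) :
    localRep (c • φ) x₀ = c • localRep φ x₀ := rfl

theorem IsSmoothForm.add {k : ℕ} {φ ψ : Form E M k} (hφ : IsSmoothForm φ) (hψ : IsSmoothForm ψ) :
    IsSmoothForm (φ + ψ) := fun x₀ => by
  rw [localRep_add]
  exact (hφ x₀).add (hψ x₀)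

theorem IsSmoothForm.smul {k : ℕ} {φ : Form E M k} (c : ℂ) (hφ : IsSmoothForm φ) :
    IsSmoothForm (c • φ) := fun x₀ => by
  rw [localRep_smul]
  exact (hφ x₀).const_smul c

theorem isSmoothForm_zero {k : ℕ} : IsSmoothForm (0 : Form E M k) := fun x₀ => by
  have : localRep (0 : Form E M k) x₀ = fun _ => 0 := rfl
  rw [this]
  exact contDiffOn_const

theorem IsSmoothForm.differentiableAt {k : ℕ} {φ : Form E M k} (hφ : IsSmoothForm φ) (x : M) :
    DifferentiableAt ℝ (localRep φ x) (extChartAt 𝓘(ℝ, E) x x) :=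
  ((hφ x).contDiffAt (extChartAt_target_mem_nhds x)).differentiableAt (by simp)

theorem extD_add {k : ℕ} {φ ψ : Form E M k} (hφ : IsSmoothForm φ) (hψ : IsSmoothForm ψ) :
    extD (φ + ψ) = extD φ + extD ψ := by
  funext x
  simp only [extD, localRep_add, extDeriv_add (hφ.differentiableAt x) (hψ.differentiableAt x)]
  rfl

theorem extD_smul {k : ℕ} (c : ℂ) {φ : Form E M k} (hφ : IsSmoothForm φ) :
    extD (c • φ) = c • extD φ := by
  funext x
  have h : extDeriv (c • localRep φ x) (extChartAt 𝓘(ℝ, E) x x) =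
      c • extDeriv (localRep φ x) (extChartAt 𝓘(ℝ, E) x x) := by
    have hd := hφ.differentiableAt x
    ext v
    simp only [extDeriv, ContinuousAlternatingMap.smul_apply,
      ContinuousAlternatingMap.alternatizeUncurryFin_apply, fderiv_const_smul hd, Finset.smul_sum]
    refine Finset.sum_congr rfl fun i _ => ?_
    exact smul_comm _ _ _
  simp only [extD, localRep_smul, h]
  rfl

theorem extD_zero {k : ℕ} : extD (0 : Form E M k) = 0 := by
  have h := extD_smul (0 : ℂ) (isSmoothForm_zero (E := E) (M := M) (k := k))
  rwa [zero_smul, zero_smul] at h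

theorem lichD_add (θ : Form E M 1) {k : ℕ} {φ ψ : Form E M k}
    (hφ : IsSmoothForm φ) (hψ : IsSmoothForm ψ) :
    lichD θ (φ + ψ) = lichD θ φ + lichD θ ψ := by
  funext x
  have h := wedgeOne_add (θ x) (φ x) (ψ x)
  simp only [lichD, extD_add hφ hψ]
  erw [h]
  exact add_sub_add_comm _ _ _ _

theorem lichD_smul (θ : Form E M 1) {k : ℕ} (c : ℂ) {φ : Form E M k} (hφ : IsSmoothForm φ) :
    lichD θ (c • φ) = c • lichD θ φ := by
  funext x
  have h := wedgeOne_smul (θ x) c (φ x)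
  simp only [lichD, extD_smul c hφ]
  erw [h]
  exact (smul_sub c _ _).symm

end Forms

/-! ### Transversally holomorphic foliations -/

/-- A transversally holomorphic foliation of complex codimension `n` (real codimension `2n`) on the
manifold `M`, given by a foliated cocycle `{U i, φ i, f i j}`: an open cover `U i` of `M`, smooth
submersions `φ i : U i → T` to a complex manifold `T` of dimension `n`, and transition maps `f i j`
from `φ i (U i ∩ U j)` to `φ j (U i ∩ U j)`, local biholomorphisms of `T` with
`φ j = f i j ∘ φ i` on `U i ∩ U j`.  (Holomorphy of the inverse of `f i j` follows from that of
`f j i`.) -/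
structure Foliation (E : Type*) [NormedAddCommGroup E] [NormedSpace ℝ E]
    (M : Type*) [TopologicalSpace M] [ChartedSpace E M] (n : ℕ)
    (T : Type*) [TopologicalSpace T] [ChartedSpace (EuclideanSpace ℂ (Fin n)) T]
    (ι : Type*) where
  U : ι → Set M
  isOpen_U : ∀ i, IsOpen (U i)
  cover : ∀ x, ∃ i, x ∈ U i
  φ : ι → M → T
  smooth_φ : ∀ i, ContMDiffOn 𝓘(ℝ, E) 𝓘(ℝ, EuclideanSpace ℂ (Fin n)) ∞ (φ i) (U i)
  submersion_φ : ∀ i, ∀ x ∈ U i,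
    Function.Surjective (mfderiv 𝓘(ℝ, E) 𝓘(ℝ, EuclideanSpace ℂ (Fin n)) (φ i) x)
  f : ι → ι → OpenPartialHomeomorph T T
  source_f : ∀ i j, (f i j).source = φ i '' (U i ∩ U j)
  holomorphic_f : ∀ i j, MDifferentiableOn 𝓘(ℂ, EuclideanSpace ℂ (Fin n))
    𝓘(ℂ, EuclideanSpace ℂ (Fin n)) (f i j) (f i j).source
  comp_f : ∀ i j, ∀ x ∈ U i ∩ U j, φ j x = f i j (φ i x)

namespace Foliation

variable {E : Type*} [NormedAddCommGroup E] [NormedSpace ℝ E]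
  {M : Type*} [TopologicalSpace M] [ChartedSpace E M] {n : ℕ}
  {T : Type*} [TopologicalSpace T] [ChartedSpace (EuclideanSpace ℂ (Fin n)) T]
  {ι : Type*} (𝓕 : Foliation E M n T ι)

/-- The differential of the submersion `φ i` at `x`, a real linear map from the tangent space of
`M` at `x` to the tangent space `ℂⁿ` of the complex manifold `T` at `φ i x`. -/
def dφ (i : ι) (x : M) : E →L[ℝ] EuclideanSpace ℂ (Fin n) :=
  mfderiv 𝓘(ℝ, E) 𝓘(ℝ, EuclideanSpace ℂ (Fin n)) (𝓕.φ i) x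

/-- The tangent space of the leaf through `x`. -/
def leafTangent (x : M) : Submodule ℝ (E) where
  carrier := {v | ∀ i, x ∈ 𝓕.U i → 𝓕.dφ i x v = 0}
  add_mem' := fun {v w} hv hw i hi => by rw [map_add, hv i hi, hw i hi, add_zero]
  zero_mem' := fun i _ => map_zero _
  smul_mem' := fun c v hv i hi => by rw [map_smul, hv i hi, smul_zero]

/-- The differentials of two of the submersions differ by a complex linear map. -/
theorem exists_complexLinear (i j : ι) {x : M} (hi : x ∈ 𝓕.U i) (hj : x ∈ 𝓕.U j) :
    ∃ A : EuclideanSpace ℂ (Fin n) →L[ℂ] EuclideanSpace ℂ (Fin n),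
      ∀ v, 𝓕.dφ j x v = A (𝓕.dφ i x v) := by
  have hsrc : 𝓕.φ i x ∈ (𝓕.f i j).source := by
    rw [𝓕.source_f]
    exact ⟨x, ⟨hi, hj⟩, rfl⟩
  have hC : MDifferentiableAt 𝓘(ℂ, EuclideanSpace ℂ (Fin n)) 𝓘(ℂ, EuclideanSpace ℂ (Fin n))
      (𝓕.f i j) (𝓕.φ i x) :=
    (𝓕.holomorphic_f i j _ hsrc).mdifferentiableAt ((𝓕.f i j).open_source.mem_nhds hsrc)
  obtain ⟨hcont, A, hA⟩ : ContinuousAt (𝓕.f i j) (𝓕.φ i x) ∧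
      ∃ A : EuclideanSpace ℂ (Fin n) →L[ℂ] EuclideanSpace ℂ (Fin n),
        HasMFDerivAt 𝓘(ℂ, EuclideanSpace ℂ (Fin n)) 𝓘(ℂ, EuclideanSpace ℂ (Fin n))
          (𝓕.f i j) (𝓕.φ i x) A :=
    ⟨hC.continuousAt, _, hC.hasMFDerivAt⟩
  have hR : HasMFDerivAt 𝓘(ℝ, EuclideanSpace ℂ (Fin n)) 𝓘(ℝ, EuclideanSpace ℂ (Fin n))
      (𝓕.f i j) (𝓕.φ i x)
      (A.restrictScalars ℝ) :=
    ⟨hcont, HasFDerivWithinAt.restrictScalars ℝ hA.2⟩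
  have hφ : MDifferentiableAt 𝓘(ℝ, E) 𝓘(ℝ, EuclideanSpace ℂ (Fin n)) (𝓕.φ i) x :=
    ((𝓕.smooth_φ i).contMDiffAt ((𝓕.isOpen_U i).mem_nhds hi)).mdifferentiableAt (by simp)
  have hcomp := hR.comp x hφ.hasMFDerivAt
  have heq : 𝓕.φ j =ᶠ[𝓝 x] (𝓕.f i j) ∘ (𝓕.φ i) := by
    filter_upwards [((𝓕.isOpen_U i).inter (𝓕.isOpen_U j)).mem_nhds ⟨hi, hj⟩] with y hy
    exact 𝓕.comp_f i j y hy
  have hj' := (hcomp.congr_of_eventuallyEq heq).mfderiv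
  refine ⟨A, fun v => ?_⟩
  have h := congrArg (fun L => L v) hj'
  exact h

theorem exists_J (x : M) :
    ∃ J : E →L[ℝ] E,
      ∀ i, x ∈ 𝓕.U i → ∀ v, 𝓕.dφ i x (J v) = Complex.I • 𝓕.dφ i x v := by
  obtain ⟨i, hi⟩ := 𝓕.cover x
  have hsurj : Function.Surjective (𝓕.dφ i x) := 𝓕.submersion_φ i x hi
  obtain ⟨s, hs⟩ := ContinuousLinearMap.exists_rightInverse_of_surjective (𝓕.dφ i x)
    (LinearMap.range_eq_top.mpr hsurj)
  have hs' : ∀ w, 𝓕.dφ i x (s w) = w := fun w => congrArg (fun L => L w) hs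
  refine ⟨s ∘L ((Complex.I • ContinuousLinearMap.id ℂ
    (EuclideanSpace ℂ (Fin n))).restrictScalars ℝ) ∘L 𝓕.dφ i x, fun j hj v => ?_⟩
  obtain ⟨A, hA⟩ := 𝓕.exists_complexLinear i j hi hj
  rw [hA, hA]
  simp [hs']

/-- A lift to the tangent space of `M` at `x` of the complex structure of the normal space
`T_xM / T_xF` that is induced by the complex structure of the transversal manifold.  It is unique
modulo `T_xF`; only its effect on forms vanishing on `T_xF` matters. -/
def J (x : M) : E →L[ℝ] E :=
  (𝓕.exists_J x).choose

theorem J_spec (x : M) (i : ι) (hi : x ∈ 𝓕.U i) (v : E) :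
    𝓕.dφ i x (𝓕.J x v) = Complex.I • 𝓕.dφ i x v :=
  (𝓕.exists_J x).choose_spec i hi v

/-- `i_X φ = 0` for all `X` tangent to the leaves. -/
def IsHorizontal {k : ℕ} (φ : Form E M k) : Prop :=
  ∀ (x : M) (v : Fin k → E) (r : Fin k),
    v r ∈ 𝓕.leafTangent x → φ x v = 0

/-- The space `Ω^k(M/F)` of basic `k`-forms: smooth forms `φ` with `i_X φ = 0` and `L_X φ = 0` for
all `X` tangent to the leaves.  Since `L_X φ = i_X dφ + d (i_X φ)`, in presence of the first
condition the second one says `i_X dφ = 0`. -/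
def basicForms (k : ℕ) : Submodule ℂ (Form E M k) where
  carrier := {φ | IsSmoothForm φ ∧ 𝓕.IsHorizontal φ ∧ 𝓕.IsHorizontal (extD φ)}
  add_mem' := by
    rintro φ ψ ⟨h1, h2, h3⟩ ⟨g1, g2, g3⟩
    refine ⟨h1.add g1, fun x v r hr => ?_, fun x v r hr => ?_⟩
    · show φ x v + ψ x v = 0
      rw [h2 x v r hr, g2 x v r hr, add_zero]
    · rw [extD_add h1 g1]
      show extD φ x v + extD ψ x v = 0
      rw [h3 x v r hr, g3 x v r hr, add_zero]
  zero_mem' := ⟨isSmoothForm_zero, fun _ _ _ _ => rfl, fun _ _ _ _ => by rw [extD_zero]; rfl⟩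
  smul_mem' := by
    rintro c φ ⟨h1, h2, h3⟩
    refine ⟨h1.smul c, fun x v r hr => ?_, fun x v r hr => ?_⟩
    · show c • φ x v = 0
      rw [h2 x v r hr, smul_zero]
    · rw [extD_smul c h1]
      show c • extD φ x v = 0
      rw [h3 x v r hr, smul_zero]

/-- The `(p,q)`-component of a `k`-form (meaningful for horizontal forms). -/
def typePart {k : ℕ} (p q : ℕ) : Form E M k →ₗ[ℂ] Form E M k where
  toFun φ := fun x => hodgePart (𝓕.J x) p q (φ x)
  map_add' φ ψ := by
    funext x
    exact map_add (hodgePart (𝓕.J x) p q) (φ x) (ψ x)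
  map_smul' c φ := by
    funext x
    exact map_smul (hodgePart (𝓕.J x) p q) c (φ x)

/-- The space `Ω^{p,q}(M/F)` of basic forms of type `(p,q)`, where `k = p + q` (it is zero for other
values of `k`): basic `k`-forms which are equal to their `(p,q)`-component. -/
def basicFormsOfType (k p q : ℕ) : Submodule ℂ (Form E M k) where
  carrier := {φ | φ ∈ 𝓕.basicForms k ∧ 𝓕.typePart p q φ = φ}
  add_mem' := by
    rintro φ ψ ⟨h1, h2⟩ ⟨g1, g2⟩
    exact ⟨add_mem h1 g1, by rw [map_add, h2, g2]⟩
  zero_mem' := ⟨zero_mem _, map_zero _⟩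
  smul_mem' := by
    rintro c φ ⟨h1, h2⟩
    exact ⟨Submodule.smul_mem _ c h1, by rw [map_smul, h2]⟩

variable (θ : Form E M 1)

/-- The basic Lichnerowicz differential `d_{b,θ} = d_b - θ ∧` on basic `k`-forms. This is also the
flat basic connection `∇_b` of the weight bundle `E`, the trivial complex line bundle with
connection `d_b - θ`, basic forms with values in `E` being identified with basic forms through
the trivialisation. -/
def dθ (k : ℕ) : 𝓕.basicForms k →ₗ[ℂ] Form E M (k + 1) where
  toFun φ := lichD θ φ.1
  map_add' φ ψ := lichD_add θ φ.2.1 ψ.2.1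
  map_smul' c φ := lichD_smul θ c φ.2.1

/-- The `(1,0)`-part `∂_{b,E}` of `∇_b = d_b - θ ∧` on `Ω^{p,q}(M/F, E)`: the
component of type `(p+1,q)` of `∇_b φ`. -/
def delE (k p q : ℕ) : 𝓕.basicFormsOfType k p q →ₗ[ℂ] Form E M (k + 1) :=
  𝓕.typePart (p + 1) q ∘ₗ 𝓕.dθ θ k ∘ₗ Submodule.inclusion (fun _ h => h.1)

/-- The `(0,1)`-part `∂̄_{b,E}` of `∇_b = d_b - θ ∧` on `Ω^{p,q}(M/F, E)`: the
component of type `(p,q+1)` of `∇_b φ`. -/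
def delbarE (k p q : ℕ) : 𝓕.basicFormsOfType k p q →ₗ[ℂ] Form E M (k + 1) :=
  𝓕.typePart p (q + 1) ∘ₗ 𝓕.dθ θ k ∘ₗ Submodule.inclusion (fun _ h => h.1)

/-- The `d_{b,θ}`-exact `k`-forms. -/
def lichExact : (k : ℕ) → Submodule ℂ (Form E M k)
  | 0 => ⊥
  | k + 1 => LinearMap.range (𝓕.dθ θ k)

/-- The basic Lichnerowicz cohomology group `H^k_θ(M/F)`. -/
abbrev LichnerowiczCohomology (k : ℕ) : Type _ :=
  LinearMap.ker (𝓕.dθ θ k) ⧸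
    ((𝓕.lichExact θ k).comap (𝓕.basicForms k).subtype).submoduleOf (LinearMap.ker (𝓕.dθ θ k))

/-- The `∂̄_{b,E}`-exact forms of type `(0,k)`. -/
def holExact : (k : ℕ) → Submodule ℂ (Form E M k)
  | 0 => ⊥
  | k + 1 => LinearMap.range (𝓕.delbarE θ k 0 k)

/-- The holomorphic basic cohomology group `H^k(M/F, 𝓔)` of the holomorphic foliated line bundle
`𝓔` underlying the weight bundle `E`: the cohomology of the complex
`Ω^{0,0}(M/F, E) → Ω^{0,1}(M/F, E) → Ω^{0,2}(M/F, E) → ⋯` with differential `∂̄_{b,E}`. -/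
abbrev HolomorphicCohomology (k : ℕ) : Type _ :=
  LinearMap.ker (𝓕.delbarE θ k 0 k) ⧸
    ((𝓕.holExact θ k).comap (𝓕.basicFormsOfType k 0 k).subtype).submoduleOf
      (LinearMap.ker (𝓕.delbarE θ k 0 k))

/-- The image of `∂_{b,E} ∂̄_{b,E} : Ω^{p-1,q-1}(M/F, E) → Ω^{p,q}(M/F, E)`, where `k = p + q`:
all `∂_{b,E} β` with `β` of type `(p-1,q)` of the form `β = ∂̄_{b,E} f`. -/
def bottChernExact : (k p q : ℕ) → Submodule ℂ (Form E M k)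
  | k + 2, p + 1, q + 1 =>
      ((LinearMap.range (𝓕.delbarE θ k p q)).comap
        (𝓕.basicFormsOfType (k + 1) p (q + 1)).subtype).map (𝓕.delE θ (k + 1) p (q + 1))
  | _, _, _ => ⊥

/-- The basic Bott–Chern cohomology group `H^{p,q}_{BC}(M/F, E)` with coefficients in the weight
bundle `E`: the kernel of `∂_{b,E} ⊕ ∂̄_{b,E}` on `Ω^{p,q}(M/F, E)` modulo the image of
`∂_{b,E} ∂̄_{b,E}`. -/
abbrev BottChernCohomology (p q : ℕ) : Type _ :=
  ↥(LinearMap.ker (𝓕.delE θ (p + q) p q) ⊓ LinearMap.ker (𝓕.delbarE θ (p + q) p q)) ⧸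
    ((𝓕.bottChernExact θ (p + q) p q).comap
      (𝓕.basicFormsOfType (p + q) p q).subtype).submoduleOf
      (LinearMap.ker (𝓕.delE θ (p + q) p q) ⊓ LinearMap.ker (𝓕.delbarE θ (p + q) p q))

/-- `(M, F, ω, θ)` is a transversally locally conformally Kähler foliation.  A transverse Hermitian
metric `g` on the normal bundle, invariant along the leaves, is given by its fundamental form `ω`
(called `ω₀` in the code),
a real basic form of type `(1,1)` with `ω(v, J v) > 0` for all `v` not tangent to the leaves
(`g(v, w) = ω(v, J w)`).  The foliation is transversally LCK if locally there are real basic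
functions `σ` such that `e^{-σ} g` is a transverse Kähler metric, i.e. `e^{-σ} ω` is closed, and `θ`
is the Lee form: the global `1`-form equal to `dσ` on the domain of each of these `σ`. -/
structure IsTransversallyLCK (ω₀ : Form E M 2) (θ : Form E M 1) : Prop where
  mem : ω₀ ∈ 𝓕.basicFormsOfType 2 1 1
  real : ∀ x v, (ω₀ x v).im = 0
  pos : ∀ x, ∀ v ∉ 𝓕.leafTangent x, 0 < (ω₀ x ![v, 𝓕.J x v]).re
  exists_potential : ∀ x : M, ∃ U : Set M, IsOpen U ∧ x ∈ U ∧ ∃ σ : M → ℝ,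
    ContMDiffOn 𝓘(ℝ, E) 𝓘(ℝ, ℝ) ∞ σ U ∧
    (∀ y ∈ U, ∀ v ∈ 𝓕.leafTangent y, mfderiv 𝓘(ℝ, E) 𝓘(ℝ, ℝ) σ y v = (0 : ℝ)) ∧
    (∀ y ∈ U, ∀ v, θ y ![v] = Complex.ofReal (mfderiv 𝓘(ℝ, E) 𝓘(ℝ, ℝ) σ y v)) ∧
    (∀ y ∈ U, extD (fun z => (Real.exp (-σ z) : ℂ) • ω₀ z) y = 0)

end Foliation

end TransLCK

end

/-!
Write `∂` and `∂̄` for the two components of `d_θ = d - θ ∧`.  A form `φ` of type `(1, 1)` with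
`∂ φ = ∂̄ φ = 0` is `d_θ`-closed, so `φ = d_θ α` because `H²_θ` vanishes.  Split
`α = α' + α''` into its parts of type `(1, 0)` and `(0, 1)`.  Comparing types in `φ = d_θ α` gives
`∂̄ α'' = 0` and `∂ α' = 0`.  As `H¹(𝓔)` vanishes, `α'' = ∂̄ f`; as `θ` is real, the conjugate of
`α'` is `∂̄`-closed too, hence equal to `∂̄ g`, that is, `α' = ∂ ḡ`.  Since `θ` is closed,
`∂ ∂̄ + ∂̄ ∂ = 0` on functions, and the `(1, 1)`-part of `φ = d_θ α` reads `φ = ∂ ∂̄ (f - ḡ)`.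
This is `exists_delE_delbarE_eq`.

The argument needs two facts about basic forms: their components of type `(p, q)` are again basic
(`typePart_mem_basicForms`), and `d_θ` maps type `(p, q)` to types `(p + 1, q)` and `(p, q + 1)`
(`exists_lichD_eq_comp`).  Both are statements about first derivatives at one point, and neither
requires writing a basic form as the pullback of a form on the transverse manifold.  In a chart let
`p` be a submersion to `ℂⁿ` defining the foliation.  A horizontal form is `y ↦ (Dp_y)^* a_y` for a
smooth family `a_y` of forms on `ℂⁿ`.  The second derivatives of `p` cancel in its exterior
derivative (`extDeriv_compContinuousLinearMap_fderiv`), so the form is basic exactly if `Da`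
vanishes on the kernel of `Dp` (`IsBasicAt`, `mem_basicForms_of_isBasicAt`).  Taking components of
type `(p, q)` amounts to applying a constant linear operator to `a`, which preserves this
condition.  Moreover `dα` is then the pullback of the antisymmetrisation of a linear map
`ℂⁿ → Λᵏ`, and splitting this map into its complex linear and antilinear parts gives the two types.

Types of forms on `ℂⁿ` are detected by scalar multiplication: `a` has type `(p, q)` if and only if
`a(zv) = z ^ p * conj z ^ q * a(v)` for all complex `z` (`HasType`, `hasType_hodgePart`,
`HasType.hodgePart_eq`).
-/

noncomputable section

namespace TransLCK

/-! ### Components of type (p, q) of alternating forms -/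

section HodgeTypes

open ComplexConjugate

variable {V : Type*} [NormedAddCommGroup V] [NormedSpace ℝ V]
  {W : Type*} [NormedAddCommGroup W] [NormedSpace ℝ W] {k : ℕ}

theorem slotEval_compContinuousLinearMap (L : V →L[ℝ] W) {J : V →L[ℝ] V} {J' : W →L[ℝ] W}
    (h : ∀ v, L (J v) = J' (L v)) (S : Finset (Fin k)) (α : W [⋀^Fin k]→L[ℝ] ℂ) (v : Fin k → V) :
    slotEval J S (α.compContinuousLinearMap L) v = slotEval J' S α (fun r => L (v r)) := by
  unfold slotEval
  congr 1
  refine Finset.sum_congr rfl fun R _ => ?_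
  congr 1
  rw [ContinuousAlternatingMap.compContinuousLinearMap_apply]
  congr 1
  funext r
  simp only [Function.comp_apply]
  split_ifs
  · exact h _
  · rfl

/-- Taking components of type `(p, q)` is natural for maps that intertwine the operators `J`. -/
theorem hodgePart_compContinuousLinearMap (L : V →L[ℝ] W) {J : V →L[ℝ] V} {J' : W →L[ℝ] W}
    (h : ∀ v, L (J v) = J' (L v)) (p q : ℕ) (α : W [⋀^Fin k]→L[ℝ] ℂ) :
    hodgePart J p q (α.compContinuousLinearMap L) =
      (hodgePart J' p q α).compContinuousLinearMap L := by
  ext v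
  rw [ContinuousAlternatingMap.compContinuousLinearMap_apply, hodgePart_apply, hodgePart_apply]
  refine Finset.sum_congr rfl fun S _ => ?_
  rw [slotEval_compContinuousLinearMap L h]
  rfl

/-- Pointwise complex conjugation of complex valued alternating forms. -/
def conjAlt : (V [⋀^Fin k]→L[ℝ] ℂ) →ₗ[ℝ] (V [⋀^Fin k]→L[ℝ] ℂ) where
  toFun α := (Complex.conjCLE : ℂ →L[ℝ] ℂ).compContinuousAlternatingMap α
  map_add' α β := by ext v; simp
  map_smul' c α := by ext v; simp

@[simp]
theorem conjAlt_apply (α : V [⋀^Fin k]→L[ℝ] ℂ) (v : Fin k → V) :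
    conjAlt α v = conj (α v) := rfl

@[simp]
theorem conjAlt_conjAlt (α : V [⋀^Fin k]→L[ℝ] ℂ) : conjAlt (conjAlt α) = α := by
  ext v
  simp

theorem slotEval_conjAlt (J : V →L[ℝ] V) (S : Finset (Fin k)) (α : V [⋀^Fin k]→L[ℝ] ℂ)
    (v : Fin k → V) : slotEval J S (conjAlt α) v = conj (slotEval J Sᶜ α v) := by
  unfold slotEval
  simp only [map_mul, map_sum, map_pow, map_prod, conjAlt_apply]
  congr 1
  · rw [map_div₀, map_one, Complex.conj_ofNat]
  refine Finset.sum_congr rfl fun R _ => ?_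
  congr 1
  refine Finset.prod_congr rfl fun r _ => ?_
  by_cases hr : r ∈ S <;> simp [hr]

/-- Complex conjugation exchanges the components of type `(p, q)` and `(q, p)`. -/
theorem hodgePart_conjAlt (J : V →L[ℝ] V) (p q : ℕ) (α : V [⋀^Fin k]→L[ℝ] ℂ) :
    hodgePart J p q (conjAlt α) = conjAlt (hodgePart J q p α) := by
  ext v
  rw [conjAlt_apply, hodgePart_apply, hodgePart_apply, map_sum,
    ← Equiv.sum_comp (Function.Involutive.toPerm compl (compl_involutive (α := Finset (Fin k))))]
  refine Finset.sum_congr rfl fun S _ => ?_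
  simp only [Function.Involutive.coe_toPerm, compl_compl, slotEval_conjAlt, and_comm]
  split_ifs <;> simp

theorem hodgePart_eq_zero_of_add_ne (J : V →L[ℝ] V) {p q : ℕ} (h : p + q ≠ k)
    (α : V [⋀^Fin k]→L[ℝ] ℂ) : hodgePart J p q α = 0 := by
  ext v
  rw [hodgePart_apply]
  refine Finset.sum_eq_zero fun S _ => if_neg ?_
  rintro ⟨rfl, rfl⟩
  apply h
  rw [Finset.card_add_card_compl, Fintype.card_fin]

/-- Expanding each argument `z v = z v^{1,0} + conj z v^{0,1}` by multilinearity. -/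
theorem apply_re_add_im_eq_sum_slotEval (J : V →L[ℝ] V) (α : V [⋀^Fin k]→L[ℝ] ℂ) (z : ℂ)
    (v : Fin k → V) :
    α (fun r => z.re • v r + z.im • J (v r)) =
      ∑ S : Finset (Fin k), z ^ S.card * conj z ^ Sᶜ.card * slotEval J S α v := by
  have hL : α (fun r => z.re • v r + z.im • J (v r)) =
      ∑ R : Finset (Fin k), ((∏ r ∈ R, (z.im : ℂ)) * ∏ r ∈ Rᶜ, (z.re : ℂ)) *
        α (fun r => if r ∈ R then J (v r) else v r) := by
    have h1 := α.toMultilinearMap.map_add_univ (fun r => z.im • J (v r)) (fun r => z.re • v r)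
    have h2 : (fun r => z.re • v r + z.im • J (v r)) =
        (fun r => z.im • J (v r)) + fun r => z.re • v r := by
      funext r
      exact add_comm _ _
    rw [h2]
    refine h1.trans (Finset.sum_congr rfl fun R _ => ?_)
    have h3 : (R.piecewise (fun r => z.im • J (v r)) fun r => z.re • v r) =
        fun r => (if r ∈ R then z.im else z.re) • (if r ∈ R then J (v r) else v r) := by
      funext r
      by_cases hr : r ∈ R <;> simp [hr]
    rw [h3]
    refine (α.toMultilinearMap.map_smul_univ _ _).trans ?_
    have h4 : (∏ r, (if r ∈ R then z.im else z.re)) = (∏ r ∈ R, z.im) * ∏ r ∈ Rᶜ, z.re := by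
      rw [Finset.prod_ite, ← Finset.compl_filter]
      simp
    rw [h4, Complex.real_smul]
    push_cast
    rfl
  rw [hL]
  unfold slotEval
  simp only [Finset.mul_sum]
  rw [Finset.sum_comm]
  refine Finset.sum_congr rfl fun R _ => ?_
  have hR : ∑ S : Finset (Fin k), z ^ S.card * conj z ^ Sᶜ.card * ((1 / 2 : ℂ) ^ k *
      ∏ r ∈ R, if r ∈ S then -Complex.I else Complex.I) =
      (∏ r ∈ R, (z.im : ℂ)) * ∏ r ∈ Rᶜ, (z.re : ℂ) := by
    have h5 : (∏ r ∈ R, (z.im : ℂ)) * ∏ r ∈ Rᶜ, (z.re : ℂ) =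
        ∏ r : Fin k, ((if r ∈ R then -Complex.I * z / 2 else z / 2) +
          if r ∈ R then Complex.I * conj z / 2 else conj z / 2) := by
      have h6 : ∀ r : Fin k, ((if r ∈ R then -Complex.I * z / 2 else z / 2) +
          if r ∈ R then Complex.I * conj z / 2 else conj z / 2) =
          if r ∈ R then (z.im : ℂ) else (z.re : ℂ) := by
        intro r
        split_ifs
        · (apply Complex.ext <;> simp); ring
        · (apply Complex.ext <;> simp); ring
      simp only [h6]
      rw [Finset.prod_ite, ← Finset.compl_filter]
      simp
    rw [h5, Fintype.prod_add]
    refine Finset.sum_congr rfl fun S _ => ?_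
    have h7 : (∏ r ∈ R, if r ∈ S then -Complex.I else Complex.I) =
        (∏ r ∈ S, if r ∈ R then -Complex.I else 1) *
          ∏ r ∈ Sᶜ, if r ∈ R then Complex.I else 1 := by
      rw [← Finset.prod_filter_mul_prod_filter_not R (· ∈ S)]
      congr 1
      · rw [← Finset.prod_filter, Finset.filter_mem_eq_inter, Finset.filter_mem_eq_inter,
          Finset.inter_comm]
        refine Finset.prod_congr rfl fun r hr => ?_
        simp [(Finset.mem_inter.mp hr).1]
      · rw [← Finset.prod_filter]
        have : R.filter (fun r => r ∉ S) = Sᶜ.filter (· ∈ R) := by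
          ext r
          simp [and_comm]
        rw [this]
        refine Finset.prod_congr rfl fun r hr => ?_
        simp only [Finset.mem_filter, Finset.mem_compl] at hr
        simp [hr.1]
    have h8 : (1 / 2 : ℂ) ^ k = (1 / 2 : ℂ) ^ S.card * (1 / 2 : ℂ) ^ Sᶜ.card := by
      rw [← pow_add, Finset.card_add_card_compl, Fintype.card_fin]
    rw [h7, h8]
    have h9 : ∀ (s : Finset (Fin k)) (c w : ℂ), (∏ r ∈ s, if r ∈ R then c * w / 2 else w / 2) =
        w ^ s.card * (1 / 2 : ℂ) ^ s.card * ∏ r ∈ s, if r ∈ R then c else 1 := by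
      intro s c w
      rw [← mul_pow, ← Finset.prod_const, ← Finset.prod_mul_distrib]
      refine Finset.prod_congr rfl fun r _ => ?_
      split_ifs <;> ring
    rw [h9, h9]
    ring
  rw [← hR, Finset.sum_mul]
  refine Finset.sum_congr rfl fun S _ => ?_
  ring

theorem apply_re_add_im_eq_sum_hodgePart (J : V →L[ℝ] V) (α : V [⋀^Fin k]→L[ℝ] ℂ) (z : ℂ)
    (v : Fin k → V) :
    α (fun r => z.re • v r + z.im • J (v r)) =
      ∑ m ∈ Finset.range (k + 1), z ^ m * conj z ^ (k - m) * hodgePart J m (k - m) α v := by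
  rw [apply_re_add_im_eq_sum_slotEval]
  have hc : ∀ S : Finset (Fin k), Sᶜ.card = k - S.card := fun S => by
    rw [Finset.card_compl, Fintype.card_fin]
  rw [← Finset.sum_fiberwise_of_maps_to (s := Finset.univ) (t := Finset.range (k + 1))
    (g := fun S : Finset (Fin k) => S.card)
    (fun S _ => Finset.mem_range.mpr (Nat.lt_succ_of_le (by simpa using S.card_le_univ)))]
  refine Finset.sum_congr rfl fun m _ => ?_
  rw [hodgePart_apply, Finset.mul_sum, Finset.sum_filter]
  refine Finset.sum_congr rfl fun S _ => ?_
  by_cases hS : S.card = m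
  · simp [hS, hc]
  · simp [hS]

/-- The components of all types add up to the form. -/
theorem sum_hodgePart (J : V →L[ℝ] V) (α : V [⋀^Fin k]→L[ℝ] ℂ) :
    ∑ m ∈ Finset.range (k + 1), hodgePart J m (k - m) α = α := by
  ext v
  have h := apply_re_add_im_eq_sum_hodgePart J α 1 v
  simp only [Complex.one_re, Complex.one_im, one_smul, zero_smul, add_zero, one_pow, map_one,
    one_mul] at h
  rw [ContinuousAlternatingMap.sum_apply]
  exact h.symm

/-- The functions `z ↦ z ^ m * conj z ^ (k - m)` are linearly independent over `ℂ`. -/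
theorem eq_of_sum_pow_mul_conj_pow_eq {c d : ℕ → ℂ}
    (h : ∀ z : ℂ, ∑ m ∈ Finset.range (k + 1), z ^ m * conj z ^ (k - m) * c m =
      ∑ m ∈ Finset.range (k + 1), z ^ m * conj z ^ (k - m) * d m) {m : ℕ} (hm : m ≤ k) :
    c m = d m := by
  -- At `z = 1 + t i` the difference of the sums, divided by `conj z ^ k`, is the value at
  -- `z / conj z` of a polynomial with coefficients `c m - d m`, which thus has infinitely many roots.
  set P : Polynomial ℂ := ∑ m ∈ Finset.range (k + 1), Polynomial.monomial m (c m - d m) with hP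
  have hne : ∀ t : ℕ, (1 - t * Complex.I : ℂ) ≠ 0 := fun t ht => by
    simpa using congrArg Complex.re ht
  have hroot : ∀ t : ℕ, P.eval ((1 + t * Complex.I) / (1 - t * Complex.I)) = 0 := by
    intro t
    have h1 := h (1 + t * Complex.I)
    have hconj : conj (1 + t * Complex.I : ℂ) = 1 - t * Complex.I := by
      simp [sub_eq_add_neg]
    rw [hconj, ← sub_eq_zero, ← Finset.sum_sub_distrib] at h1
    have h2 : (1 - t * Complex.I : ℂ) ^ k * P.eval ((1 + t * Complex.I) / (1 - t * Complex.I)) =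
        0 := by
      rw [← h1, hP, Polynomial.eval_finsetSum, Finset.mul_sum]
      refine Finset.sum_congr rfl fun m hm => ?_
      rw [Polynomial.eval_monomial, div_pow]
      have hmk : m ≤ k := Nat.lt_succ_iff.mp (Finset.mem_range.mp hm)
      have h3 : (1 - t * Complex.I : ℂ) ^ k =
          (1 - t * Complex.I) ^ m * (1 - t * Complex.I) ^ (k - m) := by
        rw [← pow_add, Nat.add_sub_cancel' hmk]
      rw [h3]
      have := pow_ne_zero m (hne t)
      field_simp
    exact (mul_eq_zero.mp h2).resolve_left (pow_ne_zero k (hne t))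
  have hinj : Function.Injective
      (fun t : ℕ => ((1 + t * Complex.I) / (1 - t * Complex.I) : ℂ)) := by
    intro s t hst
    simp only at hst
    rw [div_eq_div_iff (hne s) (hne t)] at hst
    have := congrArg Complex.im hst
    simp at this
    have h4 : (s : ℝ) = t := by linarith
    exact_mod_cast h4
  have hzero : P = 0 := Polynomial.eq_zero_of_infinite_isRoot P
    ((Set.infinite_range_of_injective hinj).mono (by rintro _ ⟨t, rfl⟩; exact hroot t))
  have hcoeff : P.coeff m = c m - d m := by
    rw [hP, Polynomial.finsetSum_coeff]
    simp only [Polynomial.coeff_monomial]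
    rw [Finset.sum_ite_eq' , if_pos (Finset.mem_range.mpr (Nat.lt_succ_of_le hm))]
  rw [hzero, Polynomial.coeff_zero] at hcoeff
  exact (sub_eq_zero.mp hcoeff.symm)

end HodgeTypes

/-! ### Forms on a complex vector space -/

section ComplexSpace

open ComplexConjugate

variable {W : Type*} [NormedAddCommGroup W] [NormedSpace ℂ W] [NormedSpace ℝ W]
  [IsScalarTower ℝ ℂ W] {k : ℕ}

variable (W) in
/-- Multiplication by `i` on a complex vector space, as a real linear map. -/
def mulI : W →L[ℝ] W := (Complex.I • ContinuousLinearMap.id ℂ W).restrictScalars ℝ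

@[simp]
theorem mulI_apply (w : W) : mulI W w = Complex.I • w := rfl

theorem re_smul_add_im_smul_mulI (z : ℂ) (w : W) : z.re • w + z.im • mulI W w = z • w := by
  rw [mulI_apply, ← smul_assoc, ← algebraMap_smul ℂ z.re w, ← add_smul]
  congr 1
  apply Complex.ext <;> simp

/-- A form on a complex vector space is of type `(p, q)` if multiplication of all arguments by `z`
multiplies it by `z ^ p * conj z ^ q`. -/
def HasType (p q : ℕ) (α : W [⋀^Fin k]→L[ℝ] ℂ) : Prop :=
  ∀ (z : ℂ) (v : Fin k → W), α (fun r => z • v r) = z ^ p * conj z ^ q * α v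

theorem apply_smul_eq_sum_hodgePart (α : W [⋀^Fin k]→L[ℝ] ℂ) (z : ℂ) (v : Fin k → W) :
    α (fun r => z • v r) =
      ∑ m ∈ Finset.range (k + 1), z ^ m * conj z ^ (k - m) * hodgePart (mulI W) m (k - m) α v := by
  rw [← apply_re_add_im_eq_sum_hodgePart]
  simp only [re_smul_add_im_smul_mulI]

/-- Compare the expansions of `α((zw)v)` and `α(z(wv))` in powers of `z` and `conj z`. -/
theorem hasType_hodgePart {p q : ℕ} (hpq : p + q = k) (α : W [⋀^Fin k]→L[ℝ] ℂ) :
    HasType p q (hodgePart (mulI W) p q α) := by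
  intro w v
  obtain rfl : q = k - p := by omega
  refine eq_of_sum_pow_mul_conj_pow_eq (k := k)
    (c := fun m => hodgePart (mulI W) m (k - m) α fun r => w • v r)
    (d := fun m => w ^ m * conj w ^ (k - m) * hodgePart (mulI W) m (k - m) α v)
    (fun z => ?_) (by omega)
  rw [← apply_smul_eq_sum_hodgePart]
  have h := apply_smul_eq_sum_hodgePart α (z * w) v
  simp only [mul_smul] at h
  rw [h]
  refine Finset.sum_congr rfl fun m _ => ?_
  rw [map_mul, mul_pow, mul_pow]
  ring

/-- Compare the two expansions of `α(zv)`; this gives all components at once. -/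
theorem HasType.hodgePart_eq {p q : ℕ} (hpq : p + q = k) {α : W [⋀^Fin k]→L[ℝ] ℂ}
    (h : HasType p q α) (m : ℕ) (hm : m ≤ k) :
    hodgePart (mulI W) m (k - m) α = if m = p then α else 0 := by
  ext v
  obtain rfl : q = k - p := by omega
  refine eq_of_sum_pow_mul_conj_pow_eq (k := k)
    (c := fun m => hodgePart (mulI W) m (k - m) α v)
    (d := fun m => (if m = p then α else 0 : W [⋀^Fin k]→L[ℝ] ℂ) v) (fun z => ?_) hm
  rw [← apply_smul_eq_sum_hodgePart, h z v, Finset.sum_eq_single p]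
  · simp
  · intro b _ hb
    simp [hb]
  · intro hp
    exact absurd (Finset.mem_range.mpr (by omega)) hp

theorem HasType.hodgePart_self {p q : ℕ} (hpq : p + q = k) {α : W [⋀^Fin k]→L[ℝ] ℂ}
    (h : HasType p q α) : hodgePart (mulI W) p q α = α := by
  have h1 := h.hodgePart_eq hpq p (by omega)
  rwa [if_pos rfl, show k - p = q by omega] at h1

theorem HasType.hodgePart_eq_zero {p q : ℕ} (hpq : p + q = k) {α : W [⋀^Fin k]→L[ℝ] ℂ}
    (h : HasType p q α) {p' q' : ℕ} (hp : p' ≠ p) : hodgePart (mulI W) p' q' α = 0 := by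
  by_cases h' : p' + q' = k
  · have h1 := h.hodgePart_eq hpq p' (by omega)
    rwa [if_neg hp, show k - p' = q' by omega] at h1
  · exact hodgePart_eq_zero_of_add_ne _ h' α

omit [IsScalarTower ℝ ℂ W] in
/-- The factor `c z` is `z` for a complex linear and `conj z` for an antilinear `b`. -/
theorem HasType.alternatizeUncurryFin {p q p' q' : ℕ} {b : W →L[ℝ] W [⋀^Fin k]→L[ℝ] ℂ}
    (h : ∀ w, HasType p q (b w)) (c : ℂ → ℂ) (hb : ∀ (z : ℂ) w, b (z • w) = c z • b w)
    (hc : ∀ z, c z * (z ^ p * conj z ^ q) = z ^ p' * conj z ^ q') :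
    HasType p' q' (ContinuousAlternatingMap.alternatizeUncurryFin b) := by
  intro z v
  simp only [ContinuousAlternatingMap.alternatizeUncurryFin_apply, Finset.mul_sum]
  refine Finset.sum_congr rfl fun i _ => ?_
  have h1 : b (z • v i) (i.removeNth fun r => z • v r) =
      c z * (z ^ p * conj z ^ q * b (v i) (i.removeNth v)) := by
    rw [hb, ContinuousAlternatingMap.smul_apply, smul_eq_mul, ← h (v i) z]
    rfl
  rw [h1, ← hc]
  simp only [zsmul_eq_mul]
  ring

/-- The antisymmetrisation of a `1`-form with values in the forms of type `(p, q)` is the sum of a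
form of type `(p + 1, q)` and one of type `(p, q + 1)`: split the `1`-form into its complex linear
and its antilinear part. -/
theorem exists_hasType_add_eq_alternatizeUncurryFin {p q : ℕ}
    {b : W →L[ℝ] W [⋀^Fin k]→L[ℝ] ℂ} (h : ∀ w, HasType p q (b w)) :
    ∃ β γ : W [⋀^Fin (k + 1)]→L[ℝ] ℂ, HasType (p + 1) q β ∧ HasType p (q + 1) γ ∧
      ContinuousAlternatingMap.alternatizeUncurryFin b = β + γ := by
  set bp : W →L[ℝ] W [⋀^Fin k]→L[ℝ] ℂ :=
    (1 / 2 : ℂ) • (b - Complex.I • (b ∘L mulI W)) with hbp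
  set bm : W →L[ℝ] W [⋀^Fin k]→L[ℝ] ℂ :=
    (1 / 2 : ℂ) • (b + Complex.I • (b ∘L mulI W)) with hbm
  have hb : ∀ (z : ℂ) w, b (z • w) = z.re • b w + z.im • b (Complex.I • w) := fun z w => by
    rw [← re_smul_add_im_smul_mulI, map_add, map_smul, map_smul, mulI_apply]
  refine ⟨ContinuousAlternatingMap.alternatizeUncurryFin bp,
    ContinuousAlternatingMap.alternatizeUncurryFin bm,
    HasType.alternatizeUncurryFin (p := p) (q := q) (fun w z v => ?_) (fun z => z)
      (fun z w => ?_) (fun z => by ring),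
    HasType.alternatizeUncurryFin (p := p) (q := q) (fun w z v => ?_) (fun z => conj z)
      (fun z w => ?_) (fun z => by ring), ?_⟩
  · have h1 := h w z v
    have h2 := h (Complex.I • w) z v
    simp [hbp, h1, h2]
    ring
  · ext v
    have h1 := hb (z * Complex.I) w
    rw [mul_smul] at h1
    simp only [hbp, _root_.smul_apply, _root_.sub_apply,
      ContinuousLinearMap.comp_apply, mulI_apply, smul_comm Complex.I z w, h1, hb z w]
    simp
    apply Complex.ext <;> simp <;> ring
  · have h1 := h w z v
    have h2 := h (Complex.I • w) z v
    simp [hbm, h1, h2]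
    ring
  · ext v
    have h1 := hb (z * Complex.I) w
    rw [mul_smul] at h1
    simp only [hbm, _root_.smul_apply, _root_.add_apply,
      ContinuousLinearMap.comp_apply, mulI_apply, smul_comm Complex.I z w, h1, hb z w]
    simp
    apply Complex.ext <;> simp <;> ring
  · rw [← ContinuousAlternatingMap.alternatizeUncurryFin_add]
    congr 1
    ext w v
    simp [hbp, hbm]
    ring

end ComplexSpace

/-! ### Basic forms for a submersion of vector spaces -/

section Calculus

variable {V : Type*} [NormedAddCommGroup V] [NormedSpace ℝ V]
  {W : Type*} [NormedAddCommGroup W] [NormedSpace ℝ W] {k : ℕ}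

instance finiteDimensional_alternating [FiniteDimensional ℝ V] :
    FiniteDimensional ℝ (V [⋀^Fin k]→L[ℝ] ℂ) := by
  let f : (V [⋀^Fin k]→L[ℝ] ℂ) →ₗ[ℝ] MultilinearMap ℝ (fun _ : Fin k => V) ℂ :=
    { toFun := fun α => α.toMultilinearMap
      map_add' := fun _ _ => rfl
      map_smul' := fun _ _ => rfl }
  exact Module.Finite.of_injective f fun α β h => by
    ext v
    exact congrArg (fun m : MultilinearMap ℝ (fun _ : Fin k => V) ℂ => m v) h

/-- In finite dimension, a family of forms is smooth as soon as all its evaluations are. -/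
theorem contDiffAt_alternating [FiniteDimensional ℝ V] {X : Type*} [NormedAddCommGroup X]
    [NormedSpace ℝ X] {m : ℕ∞ω} {f : X → V [⋀^Fin k]→L[ℝ] ℂ} {x : X}
    (h : ∀ v, ContDiffAt ℝ m (fun y => f y v) x) : ContDiffAt ℝ m f x := by
  let b := Module.finBasis ℝ V
  let ev : (V [⋀^Fin k]→L[ℝ] ℂ) →ₗ[ℝ] ((Fin k → Fin (Module.finrank ℝ V)) → ℂ) :=
    { toFun := fun α s => α fun r => b (s r)
      map_add' := fun _ _ => rfl
      map_smul' := fun _ _ => rfl }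
  have hinj : LinearMap.ker ev = ⊥ := by
    rw [LinearMap.ker_eq_bot]
    intro α β hαβ
    apply ContinuousAlternatingMap.toAlternatingMap_injective
    refine Module.Basis.ext_alternating b fun s _ => ?_
    exact congrFun hαβ s
  obtain ⟨g, hg⟩ := ev.exists_leftInverse_of_injective hinj
  have hf : f = fun y => LinearMap.toContinuousLinearMap g (ev (f y)) := by
    funext y
    exact (LinearMap.congr_fun hg (f y)).symm
  rw [hf]
  refine (LinearMap.toContinuousLinearMap g).contDiff.contDiffAt.comp x ?_
  exact contDiffAt_pi.mpr fun s => h _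

theorem ContDiffAt.compContinuousLinearMap_alternating [FiniteDimensional ℝ V] {X : Type*}
    [NormedAddCommGroup X] [NormedSpace ℝ X] {m : ℕ∞ω} {a : X → W [⋀^Fin k]→L[ℝ] ℂ}
    {L : X → V →L[ℝ] W} {x : X} (ha : ContDiffAt ℝ m a x) (hL : ContDiffAt ℝ m L x) :
    ContDiffAt ℝ m (fun y => (a y).compContinuousLinearMap (L y)) x := by
  refine contDiffAt_alternating fun v => ?_
  have h1 : ContDiffAt ℝ m (fun y =>
      ContinuousMultilinearMap.compContinuousLinearMapContinuousMultilinear ℝ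
        (fun _ : Fin k => V) (fun _ => W) ℂ (fun _ => L y)) x :=
    (ContinuousMultilinearMap.contDiff _).contDiffAt.comp x (contDiffAt_pi.mpr fun _ => hL)
  have h2 : ContDiffAt ℝ m
      (fun y => (ContinuousAlternatingMap.toContinuousMultilinearMapLI :
        W [⋀^Fin k]→L[ℝ] ℂ →ₗᵢ[ℝ] _).toContinuousLinearMap (a y)) x :=
    (ContinuousLinearMap.contDiff _).contDiffAt.comp x ha
  exact (ContinuousMultilinearMap.apply ℝ (fun _ : Fin k => V) ℂ v).contDiff.contDiffAt.comp x
    (h1.clm_apply h2)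

/-- A form annihilated by the vectors of `K` depends on its arguments modulo `K` only. -/
theorem ContinuousAlternatingMap.apply_congr_of_sub_mem {α : V [⋀^Fin k]→L[ℝ] ℂ}
    {K : Submodule ℝ V} (hα : ∀ (v : Fin k → V) (r : Fin k), v r ∈ K → α v = 0)
    {v w : Fin k → V} (h : ∀ r, v r - w r ∈ K) : α v = α w := by
  have h1 := α.toMultilinearMap.map_add_univ (v - w) w
  rw [sub_add_cancel] at h1
  refine h1.trans ((Finset.sum_eq_single ∅ (fun s _ hs => ?_) (by simp)).trans ?_)
  · obtain ⟨r, hr⟩ := Finset.nonempty_iff_ne_empty.mpr hs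
    refine hα _ r ?_
    rw [Finset.piecewise_eq_of_mem _ _ _ hr]
    exact h r
  · rw [Finset.piecewise_empty]
    rfl

theorem wedgeOne_compContinuousLinearMap (L : V →L[ℝ] W) (β : W [⋀^Fin 1]→L[ℝ] ℂ)
    (α : W [⋀^Fin k]→L[ℝ] ℂ) :
    wedgeOne (β.compContinuousLinearMap L) (α.compContinuousLinearMap L) =
      (wedgeOne β α).compContinuousLinearMap L := by
  ext v
  simp only [wedgeOne_apply, ContinuousAlternatingMap.compContinuousLinearMap_apply]
  rfl

theorem minSmoothness_two_le_infty : minSmoothness ℝ 2 ≤ (∞ : ℕ∞ω) := by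
  rw [minSmoothness_of_isRCLikeNormedField]
  exact WithTop.coe_le_coe.mpr (le_top : (2 : ℕ∞) ≤ ⊤)

/-- The exterior derivative of `y ↦ (Dp_y)^* a_y`: the second derivatives of `p` do not contribute,
because of their symmetry.  The form is the pullback of `(y, z) ↦ pr₂^* a_y` under the graph map of
`p`. -/
theorem extDeriv_compContinuousLinearMap_fderiv {p : V → W} {a : V → W [⋀^Fin k]→L[ℝ] ℂ} {y : V}
    (hp : ContDiffAt ℝ ∞ p y) (ha : DifferentiableAt ℝ a y) :
    extDeriv (fun z => (a z).compContinuousLinearMap (fderiv ℝ p z)) y =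
      ContinuousAlternatingMap.alternatizeUncurryFin
        ((ContinuousAlternatingMap.compContinuousLinearMapCLM (fderiv ℝ p y)) ∘L
          fderiv ℝ a y) := by
  -- The pullback is taken along the graph map because `a` depends on `y`, not just on `p y`.
  let A : V × W → (V × W) [⋀^Fin k]→L[ℝ] ℂ := fun z =>
    ContinuousAlternatingMap.compContinuousLinearMapCLM (ContinuousLinearMap.snd ℝ V W) (a z.1)
  let P : V → V × W := fun z => (z, p z)
  have hP : ContDiffAt ℝ ∞ P y := contDiffAt_id.prodMk hp
  have hA : HasFDerivAt A
      ((ContinuousAlternatingMap.compContinuousLinearMapCLM (ContinuousLinearMap.snd ℝ V W)) ∘L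
        fderiv ℝ a y ∘L ContinuousLinearMap.fst ℝ V W) (P y) :=
    (ContinuousLinearMap.hasFDerivAt _).comp (P y)
      (HasFDerivAt.comp (P y) (f := Prod.fst) ha.hasFDerivAt hasFDerivAt_fst)
  have hPd : ∀ᶠ z in 𝓝 y, fderiv ℝ P z = (ContinuousLinearMap.id ℝ V).prod (fderiv ℝ p z) := by
    filter_upwards [(hp.of_le (m := 1) (by exact_mod_cast le_top)).eventually (by simp)] with z hz
    exact ((hasFDerivAt_id z).prodMk (hz.differentiableAt (by simp)).hasFDerivAt).fderiv
  have heq : (fun z => (a z).compContinuousLinearMap (fderiv ℝ p z)) =ᶠ[𝓝 y]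
      fun z => (A (P z)).compContinuousLinearMap (fderiv ℝ P z) := by
    filter_upwards [hPd] with z hz
    rw [hz]
    rfl
  rw [heq.extDeriv_eq, extDeriv_pullback hA.differentiableAt hP
    minSmoothness_two_le_infty, hPd.self_of_nhds,
    extDeriv, hA.fderiv]
  ext v
  simp only [ContinuousAlternatingMap.compContinuousLinearMap_apply,
    ContinuousAlternatingMap.alternatizeUncurryFin_apply]
  rfl

/-- The form `α` is basic at `y` for the foliation by the fibres of `p`: near `y` it is the pullback
by `Dp` of a smooth family `a` of forms on the target, which is constant along the fibre of `p`
through `y` to first order at `y`. -/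
def IsBasicAt (p : V → W) (α : V → V [⋀^Fin k]→L[ℝ] ℂ) (y : V) : Prop :=
  ∃ a : V → W [⋀^Fin k]→L[ℝ] ℂ, ContDiffAt ℝ ∞ a y ∧
    (∀ᶠ z in 𝓝 y, α z = (a z).compContinuousLinearMap (fderiv ℝ p z)) ∧
    ∀ u, fderiv ℝ p y u = 0 → fderiv ℝ a y u = 0

theorem ContDiffAt.fderiv_infty {X Y : Type*} [NormedAddCommGroup X] [NormedSpace ℝ X]
    [NormedAddCommGroup Y] [NormedSpace ℝ Y] {f : X → Y} {x : X} (h : ContDiffAt ℝ ∞ f x) :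
    ContDiffAt ℝ ∞ (fderiv ℝ f) x :=
  h.fderiv_right (by simp)

theorem IsBasicAt.contDiffAt [FiniteDimensional ℝ V] {p : V → W} {α : V → V [⋀^Fin k]→L[ℝ] ℂ}
    {y : V} (h : IsBasicAt p α y) (hp : ContDiffAt ℝ ∞ p y) : ContDiffAt ℝ ∞ α y := by
  obtain ⟨a, ha, hα, -⟩ := h
  exact (ContDiffAt.compContinuousLinearMap_alternating ha
    (ContDiffAt.fderiv_infty hp)).congr_of_eventuallyEq hα

theorem IsBasicAt.apply_eq_zero {p : V → W} {α : V → V [⋀^Fin k]→L[ℝ] ℂ} {y : V}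
    (h : IsBasicAt p α y) {v : Fin k → V} {r : Fin k} (hr : fderiv ℝ p y (v r) = 0) :
    α y v = 0 := by
  obtain ⟨a, -, hα, -⟩ := h
  rw [hα.self_of_nhds]
  exact (a y).map_coord_zero r hr

/-- If `α = (Dp)^* a` with `a` constant along the fibres to first order, then `Da` factors through
a linear map `B` on the target, and `dα` is the pullback of the antisymmetrisation of `B`. -/
theorem extDeriv_eq_of_model {p : V → W} {α : V → V [⋀^Fin k]→L[ℝ] ℂ} {y : V}
    {a : V → W [⋀^Fin k]→L[ℝ] ℂ}
    (hp : ContDiffAt ℝ ∞ p y) {r : W →L[ℝ] V} (hr : ∀ w, fderiv ℝ p y (r w) = w)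
    (ha : ContDiffAt ℝ ∞ a y)
    (hα : ∀ᶠ z in 𝓝 y, α z = (a z).compContinuousLinearMap (fderiv ℝ p z))
    (hker : ∀ u, fderiv ℝ p y u = 0 → fderiv ℝ a y u = 0) :
    extDeriv α y = (ContinuousAlternatingMap.alternatizeUncurryFin
      (fderiv ℝ a y ∘L r)).compContinuousLinearMap (fderiv ℝ p y) := by
  rw [Filter.EventuallyEq.extDeriv_eq hα,
    extDeriv_compContinuousLinearMap_fderiv hp (ha.differentiableAt (by simp))]
  ext v
  simp only [ContinuousAlternatingMap.compContinuousLinearMap_apply,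
    ContinuousAlternatingMap.alternatizeUncurryFin_apply]
  refine Finset.sum_congr rfl fun i _ => ?_
  congr 1
  have h1 : fderiv ℝ a y (v i) = fderiv ℝ a y (r (fderiv ℝ p y (v i))) := by
    rw [← sub_eq_zero, ← map_sub]
    exact hker _ (by rw [map_sub, hr, sub_self])
  rw [ContinuousLinearMap.comp_apply, h1]
  rfl

theorem IsBasicAt.extDeriv_apply_eq_zero [FiniteDimensional ℝ W] {p : V → W}
    {α : V → V [⋀^Fin k]→L[ℝ] ℂ} {y : V} (h : IsBasicAt p α y) (hp : ContDiffAt ℝ ∞ p y)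
    (hsurj : Function.Surjective (fderiv ℝ p y)) {v : Fin (k + 1) → V} {r : Fin (k + 1)}
    (hr : fderiv ℝ p y (v r) = 0) : extDeriv α y v = 0 := by
  obtain ⟨a, ha, hα, hker⟩ := h
  obtain ⟨s, hs⟩ := ContinuousLinearMap.exists_rightInverse_of_surjective (fderiv ℝ p y)
    (LinearMap.range_eq_top.mpr hsurj)
  rw [extDeriv_eq_of_model hp (r := s) (fun w => congrArg (fun L => L w) hs) ha hα hker]
  rw [ContinuousAlternatingMap.compContinuousLinearMap_apply]
  exact ContinuousAlternatingMap.map_coord_zero _ r hr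

/-- A smooth form is basic at `y` if it is horizontal near `y` and its exterior derivative is
horizontal at `y`. -/
theorem isBasicAt_of_horizontal [FiniteDimensional ℝ V] [FiniteDimensional ℝ W] {p : V → W}
    {α : V → V [⋀^Fin k]→L[ℝ] ℂ} {y : V} (hp : ContDiffAt ℝ ∞ p y)
    (hsurj : Function.Surjective (fderiv ℝ p y)) (hα : ContDiffAt ℝ ∞ α y)
    (hhor : ∀ᶠ z in 𝓝 y, ∀ (v : Fin k → V) (r : Fin k), fderiv ℝ p z (v r) = 0 → α z v = 0)
    (hd : ∀ (v : Fin (k + 1) → V) (r : Fin (k + 1)), fderiv ℝ p y (v r) = 0 →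
      extDeriv α y v = 0) :
    IsBasicAt p α y := by
  obtain ⟨s, hs⟩ := ContinuousLinearMap.exists_rightInverse_of_surjective (fderiv ℝ p y)
    (LinearMap.range_eq_top.mpr hsurj)
  have hs' : ∀ w, fderiv ℝ p y (s w) = w := fun w => congrArg (fun L => L w) hs
  have hpd := ContDiffAt.fderiv_infty hp
  -- A smooth family of right inverses of the differentials `Dp_z`.
  let σ : V → W →L[ℝ] V := fun z => s ∘L (fderiv ℝ p z ∘L s).inverse
  have hcomp : ContDiffAt ℝ ∞ (fun z => fderiv ℝ p z ∘L s) y := hpd.clm_comp contDiffAt_const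
  have hid : fderiv ℝ p y ∘L s = (ContinuousLinearEquiv.refl ℝ W : W →L[ℝ] W) := hs
  have hσ : ContDiffAt ℝ ∞ σ y := by
    refine contDiffAt_const.clm_comp ?_
    refine ContDiffAt.comp y (g := ContinuousLinearMap.inverse) ?_ hcomp
    rw [hid]
    exact contDiffAt_map_inverse _
  have hinv : ∀ᶠ z in 𝓝 y, ∀ w, fderiv ℝ p z (σ z w) = w := by
    have h1 := hcomp.continuousAt.eventually_mem
      (by rw [hid]; exact ContinuousLinearEquiv.nhds (ContinuousLinearEquiv.refl ℝ W))
    filter_upwards [h1] with z hz w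
    obtain ⟨e, he⟩ := hz
    have h2 : (fderiv ℝ p z ∘L s) ((fderiv ℝ p z ∘L s).inverse w) = w := by
      rw [← he, ContinuousLinearMap.inverse_equiv]
      exact e.apply_symm_apply w
    exact h2
  let a : V → W [⋀^Fin k]→L[ℝ] ℂ := fun z => (α z).compContinuousLinearMap (σ z)
  have ha : ContDiffAt ℝ ∞ a y := ContDiffAt.compContinuousLinearMap_alternating hα hσ
  have hαa : ∀ᶠ z in 𝓝 y, α z = (a z).compContinuousLinearMap (fderiv ℝ p z) := by
    filter_upwards [hinv, hhor] with z hz hz'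
    ext v
    refine ContinuousAlternatingMap.apply_congr_of_sub_mem
      (K := LinearMap.ker (fderiv ℝ p z : V →ₗ[ℝ] W)) (fun v r hr => hz' v r hr) fun r => ?_
    rw [LinearMap.mem_ker, map_sub]
    exact sub_eq_zero.mpr (hz _).symm
  refine ⟨a, ha, hαa, fun u hu => ?_⟩
  ext w
  -- Evaluate `dα` on `u` and lifts of the vectors `w`: only the derivative along `u` survives.
  have h1 := hd (Fin.cons u fun r => s (w r)) 0 hu
  rw [Filter.EventuallyEq.extDeriv_eq hαa,
    extDeriv_compContinuousLinearMap_fderiv hp (ha.differentiableAt (by simp)),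
    ContinuousAlternatingMap.alternatizeUncurryFin_apply, Fin.sum_univ_succ] at h1
  rw [Finset.sum_eq_zero, add_zero] at h1
  · simp only [Fin.val_zero, pow_zero, one_smul, Fin.cons_zero] at h1
    have h2 : (fderiv ℝ a y u) (fun r => fderiv ℝ p y (s (w r))) = 0 := h1
    simp only [hs'] at h2
    exact h2
  · intro i _
    rcases k with _ | k
    · exact i.elim0
    · have h0 : (i.succ.removeNth (Fin.cons u fun r => s (w r) : Fin (k + 2) → V)) 0 = u := by
        simp [Fin.removeNth]
      have h3 : ((ContinuousAlternatingMap.compContinuousLinearMapCLM (fderiv ℝ p y)) ∘L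
          fderiv ℝ a y) ((Fin.cons u fun r => s (w r) : Fin (k + 2) → V) i.succ)
          (i.succ.removeNth (Fin.cons u fun r => s (w r) : Fin (k + 2) → V)) = 0 := by
        refine ((fderiv ℝ a y ((Fin.cons u fun r => s (w r) : Fin (k + 2) → V)
          i.succ)).map_coord_zero (m := fun j => fderiv ℝ p y
            (i.succ.removeNth (Fin.cons u fun r => s (w r) : Fin (k + 2) → V) j)) 0 ?_)
        rw [h0, hu]
      rw [h3, smul_zero]

/-- A constant linear operator on the forms on the target preserves basic forms. -/
theorem IsBasicAt.map {p : V → W} {α α' : V → V [⋀^Fin k]→L[ℝ] ℂ} {y : V}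
    [FiniteDimensional ℝ W] (h : IsBasicAt p α y)
    (Q : (W [⋀^Fin k]→L[ℝ] ℂ) →ₗ[ℝ] (W [⋀^Fin k]→L[ℝ] ℂ))
    (hQ : ∀ᶠ z in 𝓝 y, ∀ a : W [⋀^Fin k]→L[ℝ] ℂ,
      α z = a.compContinuousLinearMap (fderiv ℝ p z) →
      α' z = (Q a).compContinuousLinearMap (fderiv ℝ p z)) :
    IsBasicAt p α' y := by
  obtain ⟨a, ha, hα, hker⟩ := h
  have hQc : ContDiff ℝ ∞ (LinearMap.toContinuousLinearMap Q) :=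
    (LinearMap.toContinuousLinearMap Q).contDiff
  refine ⟨fun z => LinearMap.toContinuousLinearMap Q (a z), hQc.contDiffAt.comp y ha, ?_, ?_⟩
  · filter_upwards [hα, hQ] with z hz hz'
    exact hz' _ hz
  · intro u hu
    have h1 := ((LinearMap.toContinuousLinearMap Q).hasFDerivAt.comp y
      (ha.differentiableAt (by simp)).hasFDerivAt).fderiv
    have h2 : fderiv ℝ (fun z => LinearMap.toContinuousLinearMap Q (a z)) y =
        LinearMap.toContinuousLinearMap Q ∘L fderiv ℝ a y := h1
    rw [h2, ContinuousLinearMap.comp_apply, hker u hu, map_zero]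

theorem ContDiffAt.alternating_apply {X : Type*} [NormedAddCommGroup X] [NormedSpace ℝ X]
    {m : ℕ∞ω} {f : X → V [⋀^Fin k]→L[ℝ] ℂ} {x : X} (h : ContDiffAt ℝ m f x) (v : Fin k → V) :
    ContDiffAt ℝ m (fun y => f y v) x :=
  (ContinuousAlternatingMap.apply ℝ V ℂ v).contDiff.contDiffAt.comp x h

theorem ContDiffAt.wedgeOne [FiniteDimensional ℝ V] {X : Type*} [NormedAddCommGroup X]
    [NormedSpace ℝ X] {m : ℕ∞ω} {β : X → V [⋀^Fin 1]→L[ℝ] ℂ} {α : X → V [⋀^Fin k]→L[ℝ] ℂ} {x : X}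
    (hβ : ContDiffAt ℝ m β x) (hα : ContDiffAt ℝ m α x) :
    ContDiffAt ℝ m (fun y => wedgeOne (β y) (α y)) x := by
  refine contDiffAt_alternating fun v => ?_
  simp only [wedgeOne_apply]
  refine ContDiffAt.sum fun i _ => ?_
  simp only [zsmul_eq_mul]
  exact contDiffAt_const.mul
    ((ContDiffAt.alternating_apply hβ _).mul (ContDiffAt.alternating_apply hα _))

theorem fderiv_alternating_apply {X : Type*} [NormedAddCommGroup X] [NormedSpace ℝ X]
    {f : X → V [⋀^Fin k]→L[ℝ] ℂ} {x : X} (h : DifferentiableAt ℝ f x) (v : Fin k → V) (u : X) :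
    fderiv ℝ (fun y => f y v) x u = fderiv ℝ f x u v := by
  have h1 := ((ContinuousAlternatingMap.apply ℝ V ℂ v).hasFDerivAt.comp x h.hasFDerivAt).fderiv
  exact congrArg (fun L => L u) h1

theorem fderiv_wedgeOne_eq_zero [FiniteDimensional ℝ V] {X : Type*} [NormedAddCommGroup X]
    [NormedSpace ℝ X] {β : X → V [⋀^Fin 1]→L[ℝ] ℂ} {α : X → V [⋀^Fin k]→L[ℝ] ℂ} {x u : X}
    (hβ : ContDiffAt ℝ 1 β x) (hα : ContDiffAt ℝ 1 α x)
    (hβu : fderiv ℝ β x u = 0) (hαu : fderiv ℝ α x u = 0) :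
    fderiv ℝ (fun y => wedgeOne (β y) (α y)) x u = 0 := by
  have hβd := hβ.differentiableAt (by simp)
  have hαd := hα.differentiableAt (by simp)
  ext v
  rw [← fderiv_alternating_apply ((ContDiffAt.wedgeOne hβ hα).differentiableAt (by simp))]
  simp only [wedgeOne_apply, zsmul_eq_mul]
  have hd : ∀ i : Fin (k + 1), HasFDerivAt (fun y => β y fun _ => v i)
      (fderiv ℝ (fun y => β y fun _ => v i) x) x := fun i =>
    ((ContDiffAt.alternating_apply hβ _).differentiableAt (by simp)).hasFDerivAt
  have hd' : ∀ i : Fin (k + 1), HasFDerivAt (fun y => α y (i.removeNth v))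
      (fderiv ℝ (fun y => α y (i.removeNth v)) x) x := fun i =>
    ((ContDiffAt.alternating_apply hα _).differentiableAt (by simp)).hasFDerivAt
  have hsum := (HasFDerivAt.fun_sum (u := Finset.univ) fun i _ =>
    ((hd i).mul (hd' i)).const_mul ((((-1) ^ (i : ℕ) : ℤ) : ℂ))).fderiv
  simp only [Pi.mul_apply] at hsum
  rw [hsum]
  simp [sum_apply, fderiv_alternating_apply hβd, fderiv_alternating_apply hαd, hβu, hαu]

theorem IsBasicAt.wedgeOne [FiniteDimensional ℝ W] {p : V → W} {β : V → V [⋀^Fin 1]→L[ℝ] ℂ}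
    {α : V → V [⋀^Fin k]→L[ℝ] ℂ} {y : V} (hβ : IsBasicAt p β y) (hα : IsBasicAt p α y) :
    IsBasicAt p (fun z => wedgeOne (β z) (α z)) y := by
  obtain ⟨b, hb, hβb, hkb⟩ := hβ
  obtain ⟨a, ha, hαa, hka⟩ := hα
  have h1 : (1 : ℕ∞ω) ≤ ∞ := by exact_mod_cast le_top
  refine ⟨fun z => TransLCK.wedgeOne (b z) (a z), ContDiffAt.wedgeOne hb ha, ?_, fun u hu =>
    fderiv_wedgeOne_eq_zero (hb.of_le h1) (ha.of_le h1) (hkb u hu) (hka u hu)⟩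
  filter_upwards [hβb, hαa] with z hz hz'
  rw [hz, hz', wedgeOne_compContinuousLinearMap]

theorem extDeriv_wedgeOne_of_closed [FiniteDimensional ℝ V] {β : V → V [⋀^Fin 1]→L[ℝ] ℂ}
    {f : V → V [⋀^Fin 0]→L[ℝ] ℂ} {y : V} (hβ : ContDiffAt ℝ 1 β y) (hf : ContDiffAt ℝ 1 f y)
    (hd : extDeriv β y = 0) :
    extDeriv (fun z => wedgeOne (β z) (f z)) y = -wedgeOne (β y) (extDeriv f y) := by
  have hβd := hβ.differentiableAt (by simp)
  have hfd := hf.differentiableAt (by simp)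
  ext v
  have hdv := congrArg (fun γ => γ v) hd
  rw [extDeriv_apply ((ContDiffAt.wedgeOne hβ hf).differentiableAt (by simp)),
    ContinuousAlternatingMap.neg_apply, wedgeOne_apply]
  simp only [extDeriv_apply hβd] at hdv
  have hs : ∀ (z : V) (w : Fin 0 → V), f z w = f z ![] := fun z w => by rw [Subsingleton.elim w]
  have key : ∀ u w : V, fderiv ℝ (fun z => wedgeOne (β z) (f z) fun _ => w) y u =
      f y ![] * fderiv ℝ (fun z => β z fun _ => w) y u +
        β y (fun _ => w) * fderiv ℝ (fun z => f z ![]) y u := by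
    intro u w
    have h1 : (fun z => wedgeOne (β z) (f z) fun _ => w) =
        fun z => β z (fun _ => w) * f z ![] := by
      funext z
      simp [wedgeOne_apply, hs]
    rw [h1, ((((ContDiffAt.alternating_apply hβ _).differentiableAt (by simp)).hasFDerivAt).fun_mul
      (((ContDiffAt.alternating_apply hf _).differentiableAt (by simp)).hasFDerivAt)).fderiv]
    simp
    ring
  have hv : ∀ i : Fin 2, (i.removeNth v : Fin 1 → V) = fun _ => v (1 - i) := by
    intro i
    funext j
    fin_cases i <;> fin_cases j <;> rfl
  have hdf : ∀ w : V, extDeriv f y (fun _ => w) = fderiv ℝ (fun z => f z ![]) y w := by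
    intro w
    rw [extDeriv_apply hfd]
    simp [hs]
  simp only [hv, key, hdf] at hdv ⊢
  simp at hdv ⊢
  linear_combination (f y ![]) * hdv

theorem wedgeOne_wedgeOne_zero (β : V [⋀^Fin 1]→L[ℝ] ℂ) (f : V [⋀^Fin 0]→L[ℝ] ℂ) :
    wedgeOne β (wedgeOne β f) = 0 := by
  ext v
  have hv : ∀ i : Fin 2, (i.removeNth v : Fin 1 → V) = fun _ => v (1 - i) := by
    intro i
    funext j
    fin_cases i <;> fin_cases j <;> rfl
  have hs : ∀ w : Fin 0 → V, f w = f ![] := fun w => by rw [Subsingleton.elim w]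
  simp [wedgeOne_apply, Fin.sum_univ_two, hv, hs]
  ring

end Calculus

/-! ### Local expressions of forms and of their exterior derivatives -/

section Charts

variable {E : Type*} [NormedAddCommGroup E] [NormedSpace ℝ E]
  {M : Type*} [TopologicalSpace M] [ChartedSpace E M]

variable (E) in
/-- The differential of the chart at `x₀`. -/
def chartD (x₀ x : M) : E →L[ℝ] E :=
  mfderiv 𝓘(ℝ, E) 𝓘(ℝ, E) (extChartAt 𝓘(ℝ, E) x₀) x

/-- The differential of the inverse of the chart at `x₀`. -/
def chartSymmD (x₀ : M) (y : E) : E →L[ℝ] E :=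
  mfderiv 𝓘(ℝ, E) 𝓘(ℝ, E) (extChartAt 𝓘(ℝ, E) x₀).symm y

theorem localRep_eq {k : ℕ} (α : Form E M k) (x₀ : M) (y : E) :
    localRep α x₀ y =
      (α ((extChartAt 𝓘(ℝ, E) x₀).symm y)).compContinuousLinearMap (chartSymmD x₀ y) := rfl

theorem extD_eq {k : ℕ} (α : Form E M k) (x : M) :
    extD α x = (extDeriv (localRep α x) (extChartAt 𝓘(ℝ, E) x x)).compContinuousLinearMap
      (chartD E x x) := rfl

variable [IsManifold 𝓘(ℝ, E) ∞ M]

theorem chartSymmD_comp_chartD {x₀ : M} {y : E} (hy : y ∈ (extChartAt 𝓘(ℝ, E) x₀).target) :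
    chartSymmD x₀ y ∘L chartD E x₀ ((extChartAt 𝓘(ℝ, E) x₀).symm y) =
      ContinuousLinearMap.id ℝ E := by
  have h := mfderivWithin_extChartAt_symm_comp_mfderiv_extChartAt hy
  rw [ModelWithCorners.range_eq_univ, mfderivWithin_univ] at h
  exact h

theorem hasMFDerivAt_extChartAt_symm {x₀ : M} {y : E}
    (hy : y ∈ (extChartAt 𝓘(ℝ, E) x₀).target) :
    HasMFDerivAt 𝓘(ℝ, E) 𝓘(ℝ, E) (extChartAt 𝓘(ℝ, E) x₀).symm y
      (chartSymmD (E := E) x₀ y) := by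
  have h := mdifferentiableWithinAt_extChartAt_symm (I := 𝓘(ℝ, E)) hy
  rw [ModelWithCorners.range_eq_univ, mdifferentiableWithinAt_univ] at h
  exact h.hasMFDerivAt

/-- A form is recovered from its local expressions. -/
theorem apply_eq_localRep {k : ℕ} (α : Form E M k) {x₀ x : M}
    (hx : x ∈ (extChartAt 𝓘(ℝ, E) x₀).source) :
    α x = (localRep α x₀ (extChartAt 𝓘(ℝ, E) x₀ x)).compContinuousLinearMap (chartD E x₀ x) := by
  have hy := (extChartAt 𝓘(ℝ, E) x₀).map_source hx
  have h := chartSymmD_comp_chartD hy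
  rw [localRep_eq]
  rw [(extChartAt 𝓘(ℝ, E) x₀).left_inv hx] at h ⊢
  ext v
  show α x v = α x fun r => (chartSymmD x₀ (extChartAt 𝓘(ℝ, E) x₀ x) ∘L chartD E x₀ x) (v r)
  rw [h]
  rfl

theorem hasFDerivAt_transition {x₀ x₁ : M} {y : E} (hy : y ∈ (extChartAt 𝓘(ℝ, E) x₀).target)
    (hy' : (extChartAt 𝓘(ℝ, E) x₀).symm y ∈ (extChartAt 𝓘(ℝ, E) x₁).source) :
    HasFDerivAt (extChartAt 𝓘(ℝ, E) x₁ ∘ (extChartAt 𝓘(ℝ, E) x₀).symm)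
      (chartD E x₁ ((extChartAt 𝓘(ℝ, E) x₀).symm y) ∘L chartSymmD x₀ y) y := by
  rw [extChartAt_source] at hy'
  have h1 := (mdifferentiableAt_extChartAt (I := 𝓘(ℝ, E)) hy').hasMFDerivAt
  exact (h1.comp y (hasMFDerivAt_extChartAt_symm hy)).hasFDerivAt

theorem localRep_transition {k : ℕ} (α : Form E M k) {x₀ x₁ : M} {y : E}
    (hy : y ∈ (extChartAt 𝓘(ℝ, E) x₀).target)
    (hy' : (extChartAt 𝓘(ℝ, E) x₀).symm y ∈ (extChartAt 𝓘(ℝ, E) x₁).source) :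
    localRep α x₀ y =
      (localRep α x₁ ((extChartAt 𝓘(ℝ, E) x₁ ∘ (extChartAt 𝓘(ℝ, E) x₀).symm) y)
        ).compContinuousLinearMap
        (fderiv ℝ (extChartAt 𝓘(ℝ, E) x₁ ∘ (extChartAt 𝓘(ℝ, E) x₀).symm) y) := by
  rw [(hasFDerivAt_transition hy hy').fderiv, localRep_eq, apply_eq_localRep α hy']
  rfl

/-- The local expressions of `dα` are the exterior derivatives of those of `α`: the exterior
derivative does not depend on the chart. -/
theorem localRep_extD {k : ℕ} {α : Form E M k} (hα : IsSmoothForm α) {x₀ : M} {y : E}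
    (hy : y ∈ (extChartAt 𝓘(ℝ, E) x₀).target) :
    localRep (extD α) x₀ y = extDeriv (localRep α x₀) y := by
  set x := (extChartAt 𝓘(ℝ, E) x₀).symm y with hx
  have hxs : x ∈ (extChartAt 𝓘(ℝ, E) x).source := mem_extChartAt_source x
  have hx₀ : x ∈ (extChartAt 𝓘(ℝ, E) x₀).source := (extChartAt 𝓘(ℝ, E) x₀).map_target hy
  have hopen := (isOpen_extChartAt_target (I := 𝓘(ℝ, E)) x₀).mem_nhds hy
  have hcont : ContinuousAt (extChartAt 𝓘(ℝ, E) x₀).symm y :=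
    continuousAt_extChartAt_symm'' hy
  have heq : localRep α x₀ =ᶠ[𝓝 y] fun z =>
      (localRep α x ((extChartAt 𝓘(ℝ, E) x ∘ (extChartAt 𝓘(ℝ, E) x₀).symm) z)
        ).compContinuousLinearMap
        (fderiv ℝ (extChartAt 𝓘(ℝ, E) x ∘ (extChartAt 𝓘(ℝ, E) x₀).symm) z) := by
    filter_upwards [hopen,
      hcont.preimage_mem_nhds (extChartAt_source_mem_nhds (I := 𝓘(ℝ, E)) x)] with z hz hz'
    exact localRep_transition α hz hz'
  have hτ : ContDiffAt ℝ ∞ (extChartAt 𝓘(ℝ, E) x ∘ (extChartAt 𝓘(ℝ, E) x₀).symm) y := by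
    rw [← contMDiffAt_iff_contDiffAt]
    refine ContMDiffAt.comp y (I' := 𝓘(ℝ, E)) (g := extChartAt 𝓘(ℝ, E) x)
      (contMDiffAt_extChartAt' (mem_chart_source E x)) ?_
    exact (contMDiffOn_extChartAt_symm x₀).contMDiffAt hopen
  rw [Filter.EventuallyEq.extDeriv_eq heq,
    extDeriv_pullback (f := extChartAt 𝓘(ℝ, E) x ∘ (extChartAt 𝓘(ℝ, E) x₀).symm)
      (hα.differentiableAt x) hτ minSmoothness_two_le_infty,
    (hasFDerivAt_transition hy hxs).fderiv, localRep_eq, extD_eq]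
  rfl

omit [IsManifold 𝓘(ℝ, E) ∞ M] in
theorem IsSmoothForm.contDiffAt {k : ℕ} {α : Form E M k} (hα : IsSmoothForm α) {x₀ : M} {y : E}
    (hy : y ∈ (extChartAt 𝓘(ℝ, E) x₀).target) : ContDiffAt ℝ ∞ (localRep α x₀) y :=
  (hα x₀).contDiffAt ((isOpen_extChartAt_target (I := 𝓘(ℝ, E)) x₀).mem_nhds hy)

theorem localRep_extD_eventuallyEq {k : ℕ} {α : Form E M k} (hα : IsSmoothForm α) {x₀ : M} {y : E}
    (hy : y ∈ (extChartAt 𝓘(ℝ, E) x₀).target) :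
    localRep (extD α) x₀ =ᶠ[𝓝 y] extDeriv (localRep α x₀) := by
  filter_upwards [(isOpen_extChartAt_target (I := 𝓘(ℝ, E)) x₀).mem_nhds hy] with z hz
  exact localRep_extD hα hz

theorem IsSmoothForm.extD {k : ℕ} {α : Form E M k} (hα : IsSmoothForm α) :
    IsSmoothForm (extD α) := fun x₀ y hy => by
  refine (ContDiffAt.congr_of_eventuallyEq ?_
    (localRep_extD_eventuallyEq hα hy)).contDiffWithinAt
  exact (ContinuousAlternatingMap.alternatizeUncurryFinCLM ℝ E ℂ).contDiff.contDiffAt.comp y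
    (ContDiffAt.fderiv_infty (hα.contDiffAt hy))

theorem extD_extD {k : ℕ} {α : Form E M k} (hα : IsSmoothForm α) : extD (extD α) = 0 := by
  funext x
  have hy := mem_extChartAt_target (I := 𝓘(ℝ, E)) x
  rw [extD_eq, Filter.EventuallyEq.extDeriv_eq (localRep_extD_eventuallyEq hα hy),
    extDeriv_extDeriv_apply (hα.contDiffAt hy) minSmoothness_two_le_infty]
  rfl

omit [IsManifold 𝓘(ℝ, E) ∞ M] in
theorem localRep_wedgeOne {k : ℕ} (β : Form E M 1) (α : Form E M k) (x₀ : M) (y : E) :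
    localRep (fun x => wedgeOne (β x) (α x) : Form E M (k + 1)) x₀ y =
      wedgeOne (localRep β x₀ y) (localRep α x₀ y) :=
  (wedgeOne_compContinuousLinearMap _ _ _).symm

end Charts

/-! ### Local submersions and basic forms of a foliation -/

namespace Foliation

variable {E : Type*} [NormedAddCommGroup E] [NormedSpace ℝ E]
  {M : Type*} [TopologicalSpace M] [ChartedSpace E M] {n : ℕ}
  {T : Type*} [TopologicalSpace T] [ChartedSpace (EuclideanSpace ℂ (Fin n)) T]
  {ι : Type*} (𝓕 : Foliation E M n T ι)

/-- The tangent space of the leaf may be computed with any one of the submersions. -/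
theorem mem_leafTangent_iff {i : ι} {x : M} (hi : x ∈ 𝓕.U i) (v : E) :
    v ∈ 𝓕.leafTangent x ↔ 𝓕.dφ i x v = 0 := by
  refine ⟨fun h => h i hi, fun h j hj => ?_⟩
  obtain ⟨A, hA⟩ := 𝓕.exists_complexLinear i j hi hj
  rw [hA, h, map_zero]

/-- `p` is, in the chart at `x₀` and near `y`, a submersion to `ℂⁿ` defining the foliation together
with its transverse complex structure. -/
def IsLocalSubmersion (x₀ : M) (y : E) (p : E → EuclideanSpace ℂ (Fin n)) : Prop :=
  ContDiffAt ℝ ∞ p y ∧ ∀ᶠ z in 𝓝 y, ∃ i, (extChartAt 𝓘(ℝ, E) x₀).symm z ∈ 𝓕.U i ∧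
    ∃ A : EuclideanSpace ℂ (Fin n) ≃L[ℂ] EuclideanSpace ℂ (Fin n), ∀ v,
      fderiv ℝ p z v = A (𝓕.dφ i ((extChartAt 𝓘(ℝ, E) x₀).symm z) (chartSymmD x₀ z v))

theorem exists_isLocalSubmersion [IsManifold 𝓘(ℝ, E) ∞ M]
    [IsManifold 𝓘(ℂ, EuclideanSpace ℂ (Fin n)) ω T] {x₀ : M} {y : E}
    (hy : y ∈ (extChartAt 𝓘(ℝ, E) x₀).target) : ∃ p, 𝓕.IsLocalSubmersion x₀ y p := by
  set e := extChartAt 𝓘(ℝ, E) x₀ with he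
  have htarget := (isOpen_extChartAt_target (I := 𝓘(ℝ, E)) x₀).mem_nhds hy
  have hcont : ContinuousAt e.symm y := continuousAt_extChartAt_symm'' hy
  obtain ⟨i, hi⟩ := 𝓕.cover (e.symm y)
  have hφ := (𝓕.smooth_φ i).contMDiffAt ((𝓕.isOpen_U i).mem_nhds hi)
  set c := extChartAt 𝓘(ℝ, EuclideanSpace ℂ (Fin n)) (𝓕.φ i (e.symm y)) with hc
  refine ⟨c ∘ 𝓕.φ i ∘ e.symm, ?_, ?_⟩
  · rw [← contMDiffAt_iff_contDiffAt]
    exact ContMDiffAt.comp y (g := c ∘ 𝓕.φ i) (contMDiffAt_iff_target.mp hφ).2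
      ((contMDiffOn_extChartAt_symm x₀).contMDiffAt htarget)
  · have hsrc : ∀ᶠ x in 𝓝 (e.symm y), 𝓕.φ i x ∈
        (chartAt (EuclideanSpace ℂ (Fin n)) (𝓕.φ i (e.symm y))).source :=
      hφ.continuousAt.eventually_mem
        (chart_source_mem_nhds (EuclideanSpace ℂ (Fin n)) (𝓕.φ i (e.symm y)))
    filter_upwards [htarget, hcont.eventually_mem ((𝓕.isOpen_U i).mem_nhds hi),
      hcont.eventually hsrc] with z hz hzU hzs
    have h1 : MDifferentiableAt 𝓘(ℂ, EuclideanSpace ℂ (Fin n)) 𝓘(ℂ, EuclideanSpace ℂ (Fin n))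
        (extChartAt 𝓘(ℂ, EuclideanSpace ℂ (Fin n)) (𝓕.φ i (e.symm y))) (𝓕.φ i (e.symm z)) :=
      mdifferentiableAt_extChartAt hzs
    obtain ⟨A, hA⟩ : ∃ A : EuclideanSpace ℂ (Fin n) ≃L[ℂ] EuclideanSpace ℂ (Fin n),
        (A : EuclideanSpace ℂ (Fin n) →L[ℂ] EuclideanSpace ℂ (Fin n)) =
          mfderiv 𝓘(ℂ, EuclideanSpace ℂ (Fin n)) 𝓘(ℂ, EuclideanSpace ℂ (Fin n))
            (extChartAt 𝓘(ℂ, EuclideanSpace ℂ (Fin n)) (𝓕.φ i (e.symm y)))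
            (𝓕.φ i (e.symm z)) := isInvertible_mfderiv_extChartAt
      (I := 𝓘(ℂ, EuclideanSpace ℂ (Fin n))) (x := 𝓕.φ i (e.symm y)) (y := 𝓕.φ i (e.symm z))
      (by rwa [extChartAt_source])
    have hA' : HasMFDerivAt 𝓘(ℂ, EuclideanSpace ℂ (Fin n)) 𝓘(ℂ, EuclideanSpace ℂ (Fin n))
        (extChartAt 𝓘(ℂ, EuclideanSpace ℂ (Fin n)) (𝓕.φ i (e.symm y))) (𝓕.φ i (e.symm z))
        (A : EuclideanSpace ℂ (Fin n) →L[ℂ] EuclideanSpace ℂ (Fin n)) := by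
      rw [hA]
      exact h1.hasMFDerivAt
    -- A holomorphic map is real differentiable, with the same differential.
    have hR : HasMFDerivAt 𝓘(ℝ, EuclideanSpace ℂ (Fin n)) 𝓘(ℝ, EuclideanSpace ℂ (Fin n))
        c (𝓕.φ i (e.symm z))
        ((A : EuclideanSpace ℂ (Fin n) →L[ℂ] EuclideanSpace ℂ (Fin n)).restrictScalars ℝ) :=
      ⟨h1.continuousAt, HasFDerivWithinAt.restrictScalars ℝ hA'.2⟩
    have hφz : MDifferentiableAt 𝓘(ℝ, E) 𝓘(ℝ, EuclideanSpace ℂ (Fin n)) (𝓕.φ i) (e.symm z) :=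
      ((𝓕.smooth_φ i).contMDiffAt ((𝓕.isOpen_U i).mem_nhds hzU)).mdifferentiableAt (by simp)
    have hcomp := (hR.comp (e.symm z) hφz.hasMFDerivAt).comp z (hasMFDerivAt_extChartAt_symm hz)
    refine ⟨i, hzU, A, fun v => ?_⟩
    -- The same composite, typed with the model spaces in place of the tangent spaces.
    have hF : HasFDerivAt (c ∘ 𝓕.φ i ∘ e.symm)
        ((A : EuclideanSpace ℂ (Fin n) →L[ℂ] EuclideanSpace ℂ (Fin n)).restrictScalars ℝ ∘L
          𝓕.dφ i (e.symm z) ∘L chartSymmD x₀ z) z := hcomp.hasFDerivAt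
    rw [hF.fderiv]
    rfl

section LocalSubmersion

variable {𝓕} {x₀ : M} {y : E} {p : E → EuclideanSpace ℂ (Fin n)}

theorem IsLocalSubmersion.eventually_mem_leafTangent_iff (hp : 𝓕.IsLocalSubmersion x₀ y p) :
    ∀ᶠ z in 𝓝 y, ∀ v, chartSymmD x₀ z v ∈ 𝓕.leafTangent ((extChartAt 𝓘(ℝ, E) x₀).symm z) ↔
      fderiv ℝ p z v = 0 := by
  filter_upwards [hp.2] with z hz v
  obtain ⟨i, hi, A, hA⟩ := hz
  rw [𝓕.mem_leafTangent_iff hi, hA]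
  simp

theorem IsLocalSubmersion.eventually_intertwines (hp : 𝓕.IsLocalSubmersion x₀ y p) :
    ∀ᶠ z in 𝓝 y, ∀ v w,
      chartSymmD x₀ z w = 𝓕.J ((extChartAt 𝓘(ℝ, E) x₀).symm z) (chartSymmD x₀ z v) →
      fderiv ℝ p z w = Complex.I • fderiv ℝ p z v := by
  filter_upwards [hp.2] with z hz v w hvw
  obtain ⟨i, hi, A, hA⟩ := hz
  rw [hA, hA, hvw, 𝓕.J_spec _ i hi, map_smul]

theorem IsLocalSubmersion.surjective [IsManifold 𝓘(ℝ, E) ∞ M]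
    (hp : 𝓕.IsLocalSubmersion x₀ y p)
    (hy : y ∈ (extChartAt 𝓘(ℝ, E) x₀).target) : Function.Surjective (fderiv ℝ p y) := by
  obtain ⟨i, hi, A, hA⟩ := hp.2.self_of_nhds
  intro w
  obtain ⟨u, hu⟩ := 𝓕.submersion_φ i _ hi (A.symm w)
  refine ⟨chartD E x₀ ((extChartAt 𝓘(ℝ, E) x₀).symm y) u, ?_⟩
  have h := congrArg (fun L => L u) (chartSymmD_comp_chartD hy)
  rw [hA]
  erw [h]
  show A (𝓕.dφ i _ u) = w
  have hu' : 𝓕.dφ i ((extChartAt 𝓘(ℝ, E) x₀).symm y) u = A.symm w := hu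
  rw [hu', A.apply_symm_apply]

end LocalSubmersion

variable [FiniteDimensional ℝ E] [IsManifold 𝓘(ℝ, E) ∞ M]

variable {𝓕} in
theorem isBasicAt_localRep {k : ℕ} {α : Form E M k} (hα : α ∈ 𝓕.basicForms k) {x₀ : M} {y : E}
    (hy : y ∈ (extChartAt 𝓘(ℝ, E) x₀).target) {p : E → EuclideanSpace ℂ (Fin n)}
    (hp : 𝓕.IsLocalSubmersion x₀ y p) : IsBasicAt p (localRep α x₀) y := by
  obtain ⟨hs, hh, hd⟩ := hα
  refine isBasicAt_of_horizontal hp.1 (hp.surjective hy) (hs.contDiffAt hy) ?_ ?_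
  · filter_upwards [hp.eventually_mem_leafTangent_iff] with z hz v r hr
    exact hh _ _ r ((hz _).mpr hr)
  · intro v r hr
    rw [← localRep_extD hs hy]
    exact hd _ _ r ((hp.eventually_mem_leafTangent_iff.self_of_nhds _).mpr hr)

variable [IsManifold 𝓘(ℂ, EuclideanSpace ℂ (Fin n)) ω T]

/-- A form is basic if and only if its local expressions are, for the local submersions defining
the foliation. -/
theorem mem_basicForms_of_isBasicAt {k : ℕ} {α : Form E M k}
    (h : ∀ (x₀ : M) (y : E) (p : E → EuclideanSpace ℂ (Fin n)),
      y ∈ (extChartAt 𝓘(ℝ, E) x₀).target → 𝓕.IsLocalSubmersion x₀ y p →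
      IsBasicAt p (localRep α x₀) y) :
    α ∈ 𝓕.basicForms k := by
  have hker : ∀ (x : M) (p : E → EuclideanSpace ℂ (Fin n)),
      𝓕.IsLocalSubmersion x (extChartAt 𝓘(ℝ, E) x x) p → ∀ v ∈ 𝓕.leafTangent x,
      fderiv ℝ p (extChartAt 𝓘(ℝ, E) x x) (chartD E x x v) = 0 := by
    intro x p hp v hv
    have hl := (extChartAt 𝓘(ℝ, E) x).left_inv (mem_extChartAt_source (I := 𝓘(ℝ, E)) x)
    have h1 := congrArg (fun L => L v)
      (chartSymmD_comp_chartD (mem_extChartAt_target (I := 𝓘(ℝ, E)) x))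
    rw [hl] at h1
    refine (hp.eventually_mem_leafTangent_iff.self_of_nhds _).mp ?_
    erw [h1]
    rw [hl]
    exact hv
  refine ⟨fun x₀ y hy => ?_, fun x v r hr => ?_, fun x v r hr => ?_⟩
  · obtain ⟨p, hp⟩ := 𝓕.exists_isLocalSubmersion hy
    exact ((h x₀ y p hy hp).contDiffAt hp.1).contDiffWithinAt
  · have hy := mem_extChartAt_target (I := 𝓘(ℝ, E)) x
    obtain ⟨p, hp⟩ := 𝓕.exists_isLocalSubmersion hy
    rw [apply_eq_localRep α (mem_extChartAt_source (I := 𝓘(ℝ, E)) x)]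
    exact (h x _ p hy hp).apply_eq_zero (r := r) (hker x p hp _ hr)
  · have hy := mem_extChartAt_target (I := 𝓘(ℝ, E)) x
    obtain ⟨p, hp⟩ := 𝓕.exists_isLocalSubmersion hy
    rw [extD_eq]
    exact (h x _ p hy hp).extDeriv_apply_eq_zero hp.1 (hp.surjective hy) (r := r)
      (hker x p hp _ hr)

end Foliation

/-! ### The Lichnerowicz differential -/

section Lichnerowicz

variable {E : Type*} [NormedAddCommGroup E] [NormedSpace ℝ E]
  {M : Type*} [TopologicalSpace M] [ChartedSpace E M] {k : ℕ}

/-- The product `β ∧ α` of a `1`-form and a `k`-form on a manifold. -/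
def wedgeForm (β : Form E M 1) (α : Form E M k) : Form E M (k + 1) :=
  fun x => wedgeOne (β x) (α x)

theorem lichD_eq (θ : Form E M 1) (α : Form E M k) : lichD θ α = extD α - wedgeForm θ α := rfl

theorem extD_sub {φ ψ : Form E M k} (hφ : IsSmoothForm φ) (hψ : IsSmoothForm ψ) :
    extD (φ - ψ) = extD φ - extD ψ := by
  rw [sub_eq_add_neg, ← neg_one_smul ℂ ψ, extD_add hφ (hψ.smul _), extD_smul _ hψ,
    neg_one_smul, ← sub_eq_add_neg]

theorem lichD_sub (θ : Form E M 1) {φ ψ : Form E M k} (hφ : IsSmoothForm φ)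
    (hψ : IsSmoothForm ψ) : lichD θ (φ - ψ) = lichD θ φ - lichD θ ψ := by
  rw [sub_eq_add_neg, ← neg_one_smul ℂ ψ, lichD_add θ hφ (hψ.smul _), lichD_smul θ _ hψ,
    neg_one_smul, ← sub_eq_add_neg]

omit [TopologicalSpace M] [ChartedSpace E M] in
theorem wedgeForm_sub (β : Form E M 1) (φ ψ : Form E M k) :
    wedgeForm β (φ - ψ) = wedgeForm β φ - wedgeForm β ψ := by
  funext x
  ext v
  show wedgeOne (β x) (φ x - ψ x) v = wedgeOne (β x) (φ x) v - wedgeOne (β x) (ψ x) v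
  simp [wedgeOne_apply, mul_sub, Finset.sum_sub_distrib, smul_sub]

variable [FiniteDimensional ℝ E] [IsManifold 𝓘(ℝ, E) ∞ M]

omit [IsManifold 𝓘(ℝ, E) ∞ M] in
theorem IsSmoothForm.wedgeForm {β : Form E M 1} {α : Form E M k} (hβ : IsSmoothForm β)
    (hα : IsSmoothForm α) : IsSmoothForm (wedgeForm β α) := fun x₀ y hy => by
  have h : localRep (TransLCK.wedgeForm β α) x₀ =
      fun z => wedgeOne (localRep β x₀ z) (localRep α x₀ z) := by
    funext z
    exact localRep_wedgeOne β α x₀ z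
  rw [h]
  exact (ContDiffAt.wedgeOne (hβ.contDiffAt hy) (hα.contDiffAt hy)).contDiffWithinAt

theorem extD_wedgeForm_of_closed {θ : Form E M 1} {f : Form E M 0} (hθ : IsSmoothForm θ)
    (hd : extD θ = 0) (hf : IsSmoothForm f) :
    extD (wedgeForm θ f) = -wedgeForm θ (extD f) := by
  have h1 : (1 : ℕ∞ω) ≤ ∞ := by exact_mod_cast le_top
  funext x
  have hy := mem_extChartAt_target (I := 𝓘(ℝ, E)) x
  have h : localRep (wedgeForm θ f) x =
      fun z => wedgeOne (localRep θ x z) (localRep f x z) := by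
    funext z
    exact localRep_wedgeOne θ f x z
  have hθd : extDeriv (localRep θ x) (extChartAt 𝓘(ℝ, E) x x) = 0 := by
    rw [← localRep_extD hθ hy, hd]
    rfl
  rw [extD_eq, h, extDeriv_wedgeOne_of_closed ((hθ.contDiffAt hy).of_le h1)
    ((hf.contDiffAt hy).of_le h1) hθd]
  show _ = -wedgeOne (θ x) (extD f x)
  rw [apply_eq_localRep θ (mem_extChartAt_source (I := 𝓘(ℝ, E)) x), extD_eq,
    wedgeOne_compContinuousLinearMap]
  rfl

/-- For closed `θ` the operator `d - θ ∧` has square zero; the case of functions. -/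
theorem lichD_lichD {θ : Form E M 1} {f : Form E M 0} (hθ : IsSmoothForm θ)
    (hd : extD θ = 0) (hf : IsSmoothForm f) : lichD θ (lichD θ f) = 0 := by
  have h0 : wedgeForm θ (wedgeForm θ f) = 0 := by
    funext x
    exact wedgeOne_wedgeOne_zero _ _
  rw [lichD_eq, lichD_eq, extD_sub hf.extD (hθ.wedgeForm hf), extD_extD hf,
    extD_wedgeForm_of_closed hθ hd hf, wedgeForm_sub, h0]
  simp

end Lichnerowicz

/-! ### Complex conjugation of forms -/

section Conjugation

variable {E : Type*} [NormedAddCommGroup E] [NormedSpace ℝ E]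
  {M : Type*} [TopologicalSpace M] [ChartedSpace E M] {k : ℕ}

/-- Complex conjugation of forms. -/
def conjForm (α : Form E M k) : Form E M k := fun x => conjAlt (α x)

omit [TopologicalSpace M] [ChartedSpace E M] in
@[simp]
theorem conjForm_conjForm (α : Form E M k) : conjForm (conjForm α) = α := by
  funext x
  exact conjAlt_conjAlt _

omit [TopologicalSpace M] [ChartedSpace E M] in
theorem conjForm_sub (α β : Form E M k) : conjForm (α - β) = conjForm α - conjForm β := by
  funext x
  exact map_sub conjAlt _ _

omit [TopologicalSpace M] [ChartedSpace E M] in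
theorem conjForm_zero : conjForm (0 : Form E M k) = 0 := by
  funext x
  exact map_zero conjAlt

omit [TopologicalSpace M] [ChartedSpace E M] in
theorem conjForm_wedgeForm (β : Form E M 1) (α : Form E M k) :
    conjForm (wedgeForm β α) = wedgeForm (conjForm β) (conjForm α) := by
  funext x
  ext v
  show conjAlt (wedgeOne (β x) (α x)) v = wedgeOne (conjAlt (β x)) (conjAlt (α x)) v
  simp [wedgeOne_apply]

variable [FiniteDimensional ℝ E]

theorem IsSmoothForm.conjForm {α : Form E M k} (hα : IsSmoothForm α) :
    IsSmoothForm (conjForm α) := fun x₀ =>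
  (LinearMap.toContinuousLinearMap
    (conjAlt : (E [⋀^Fin k]→L[ℝ] ℂ) →ₗ[ℝ] _)).contDiff.comp_contDiffOn (hα x₀)

theorem extD_conjForm {α : Form E M k} (hα : IsSmoothForm α) :
    extD (conjForm α) = conjForm (extD α) := by
  funext x
  have h1 := ((LinearMap.toContinuousLinearMap
    (conjAlt : (E [⋀^Fin k]→L[ℝ] ℂ) →ₗ[ℝ] _)).hasFDerivAt.comp _
      (hα.differentiableAt x).hasFDerivAt).fderiv
  have h2 : fderiv ℝ (localRep (conjForm α) x) (extChartAt 𝓘(ℝ, E) x x) =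
      LinearMap.toContinuousLinearMap (conjAlt : (E [⋀^Fin k]→L[ℝ] ℂ) →ₗ[ℝ] _) ∘L
        fderiv ℝ (localRep α x) (extChartAt 𝓘(ℝ, E) x x) := h1
  rw [extD_eq, extDeriv, h2]
  show _ = conjAlt (extD α x)
  rw [extD_eq, extDeriv]
  ext v
  simp [ContinuousAlternatingMap.alternatizeUncurryFin_apply]

theorem lichD_conjForm {θ : Form E M 1} (hθ : conjForm θ = θ) {α : Form E M k}
    (hα : IsSmoothForm α) : lichD θ (conjForm α) = conjForm (lichD θ α) := by
  rw [lichD_eq, lichD_eq, conjForm_sub, conjForm_wedgeForm, hθ, extD_conjForm hα]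

end Conjugation

/-! ### Types of basic forms and of their differentials -/

namespace Foliation

variable {E : Type*} [NormedAddCommGroup E] [NormedSpace ℝ E]
  {M : Type*} [TopologicalSpace M] [ChartedSpace E M] {n : ℕ}
  {T : Type*} [TopologicalSpace T] [ChartedSpace (EuclideanSpace ℂ (Fin n)) T]
  {ι : Type*} {𝓕 : Foliation E M n T ι} {k : ℕ}

theorem typePart_apply (p q : ℕ) (α : Form E M k) (x : M) :
    𝓕.typePart p q α x = hodgePart (𝓕.J x) p q (α x) := rfl

theorem typePart_conjForm (p q : ℕ) (α : Form E M k) :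
    𝓕.typePart p q (conjForm α) = conjForm (𝓕.typePart q p α) := by
  funext x
  exact hodgePart_conjAlt _ _ _ _

/-- At each point, a horizontal form is the pullback of a form on the transverse space `ℂⁿ`. -/
theorem IsHorizontal.exists_eq_comp {α : Form E M k} (hα : 𝓕.IsHorizontal α) (x : M) :
    ∃ (L : E →L[ℝ] EuclideanSpace ℂ (Fin n)) (a : EuclideanSpace ℂ (Fin n) [⋀^Fin k]→L[ℝ] ℂ),
      (∀ v, L (𝓕.J x v) = mulI _ (L v)) ∧ α x = a.compContinuousLinearMap L := by
  obtain ⟨i, hi⟩ := 𝓕.cover x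
  have hsurj : Function.Surjective (𝓕.dφ i x) := 𝓕.submersion_φ i x hi
  obtain ⟨s, hs⟩ := ContinuousLinearMap.exists_rightInverse_of_surjective (𝓕.dφ i x)
    (LinearMap.range_eq_top.mpr hsurj)
  have hs' : ∀ w, 𝓕.dφ i x (s w) = w := fun w => congrArg (fun L => L w) hs
  refine ⟨𝓕.dφ i x, (α x).compContinuousLinearMap s, fun v => 𝓕.J_spec x i hi v, ?_⟩
  ext v
  refine ContinuousAlternatingMap.apply_congr_of_sub_mem (K := 𝓕.leafTangent x)
    (fun v r hr => hα x v r hr) fun r => ?_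
  rw [𝓕.mem_leafTangent_iff hi, map_sub]
  exact sub_eq_zero.mpr (hs' _).symm

theorem IsHorizontal.typePart_typePart {α : Form E M k} (hα : 𝓕.IsHorizontal α) {p q : ℕ}
    (hpq : p + q = k) : 𝓕.typePart p q (𝓕.typePart p q α) = 𝓕.typePart p q α := by
  funext x
  obtain ⟨L, a, hL, ha⟩ := hα.exists_eq_comp x
  rw [typePart_apply, typePart_apply, ha, hodgePart_compContinuousLinearMap L hL,
    hodgePart_compContinuousLinearMap L hL, (hasType_hodgePart hpq a).hodgePart_self hpq]

theorem typePart_eq_zero_of_ne {α : Form E M k} (hα : 𝓕.IsHorizontal α) {p q p' q' : ℕ}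
    (hpq : p + q = k) (htype : 𝓕.typePart p q α = α) (hp : p' ≠ p) :
    𝓕.typePart p' q' α = 0 := by
  funext x
  obtain ⟨L, a, hL, ha⟩ := hα.exists_eq_comp x
  rw [← htype, typePart_apply, typePart_apply, ha, hodgePart_compContinuousLinearMap L hL,
    hodgePart_compContinuousLinearMap L hL, (hasType_hodgePart hpq a).hodgePart_eq_zero hpq hp]
  rfl

theorem typePart_one_add (α : Form E M 1) :
    𝓕.typePart 1 0 α + 𝓕.typePart 0 1 α = α := by
  funext x
  have h := sum_hodgePart (𝓕.J x) (α x)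
  rw [Finset.sum_range_succ, Finset.sum_range_one] at h
  exact (add_comm _ _).trans h

variable [IsManifold 𝓘(ℝ, E) ∞ M]

/-- In terms of a local submersion, taking the component of type `(p, q)` is the constant linear
operator with the same name on the forms on `ℂⁿ`. -/
theorem IsLocalSubmersion.eventually_localRep_typePart {x₀ : M} {y : E}
    {π : E → EuclideanSpace ℂ (Fin n)} (hπ : 𝓕.IsLocalSubmersion x₀ y π)
    (hy : y ∈ (extChartAt 𝓘(ℝ, E) x₀).target) (p q : ℕ) (α : Form E M k) :
    ∀ᶠ z in 𝓝 y, ∀ a : EuclideanSpace ℂ (Fin n) [⋀^Fin k]→L[ℝ] ℂ,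
      localRep α x₀ z = a.compContinuousLinearMap (fderiv ℝ π z) →
      localRep (𝓕.typePart p q α) x₀ z =
        (hodgePart (mulI _) p q a).compContinuousLinearMap (fderiv ℝ π z) := by
  filter_upwards [hπ.eventually_intertwines,
    (isOpen_extChartAt_target (I := 𝓘(ℝ, E)) x₀).mem_nhds hy] with z hz hzt a ha
  set x := (extChartAt 𝓘(ℝ, E) x₀).symm z with hx
  -- The endomorphism `J` read in the chart.
  let J' : E →L[ℝ] E := chartD E x₀ x ∘L 𝓕.J x ∘L chartSymmD x₀ z
  have hJ' : ∀ v, chartSymmD x₀ z (J' v) = 𝓕.J x (chartSymmD x₀ z v) := fun v =>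
    congrArg (fun L : E →L[ℝ] E => L (𝓕.J x (chartSymmD x₀ z v))) (chartSymmD_comp_chartD hzt)
  rw [localRep_eq, typePart_apply, ← hodgePart_compContinuousLinearMap (chartSymmD x₀ z) hJ',
    ← localRep_eq, ha]
  exact hodgePart_compContinuousLinearMap _ (fun v => hz v (J' v) (hJ' v)) p q a

variable [FiniteDimensional ℝ E]

variable [IsManifold 𝓘(ℂ, EuclideanSpace ℂ (Fin n)) ω T]

theorem typePart_mem_basicForms {α : Form E M k} (hα : α ∈ 𝓕.basicForms k) (p q : ℕ) :
    𝓕.typePart p q α ∈ 𝓕.basicForms k :=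
  𝓕.mem_basicForms_of_isBasicAt fun _ _ _ hy hπ =>
    (isBasicAt_localRep hα hy hπ).map ((hodgePart (mulI _) p q).restrictScalars ℝ)
      (hπ.eventually_localRep_typePart hy p q α)

theorem typePart_mem_basicFormsOfType {α : Form E M k} (hα : α ∈ 𝓕.basicForms k) {p q : ℕ}
    (hpq : p + q = k) : 𝓕.typePart p q α ∈ 𝓕.basicFormsOfType k p q :=
  ⟨typePart_mem_basicForms hα p q, IsHorizontal.typePart_typePart hα.2.1 hpq⟩

omit [IsManifold 𝓘(ℝ, E) ∞ M] [IsManifold 𝓘(ℂ, EuclideanSpace ℂ (Fin n)) ω T] in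
theorem conjForm_mem_basicForms {α : Form E M k} (hα : α ∈ 𝓕.basicForms k) :
    conjForm α ∈ 𝓕.basicForms k := by
  refine ⟨hα.1.conjForm, fun x v r hr => ?_, fun x v r hr => ?_⟩
  · show (starRingEnd ℂ) (α x v) = 0
    rw [hα.2.1 x v r hr, map_zero]
  · rw [extD_conjForm hα.1]
    show (starRingEnd ℂ) (extD α x v) = 0
    rw [hα.2.2 x v r hr, map_zero]

omit [IsManifold 𝓘(ℝ, E) ∞ M] [IsManifold 𝓘(ℂ, EuclideanSpace ℂ (Fin n)) ω T] in
theorem conjForm_mem_basicFormsOfType {α : Form E M k} {p q : ℕ}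
    (hα : α ∈ 𝓕.basicFormsOfType k p q) : conjForm α ∈ 𝓕.basicFormsOfType k q p :=
  ⟨conjForm_mem_basicForms hα.1, by rw [typePart_conjForm, hα.2]⟩

theorem wedgeForm_mem_basicForms {β : Form E M 1} {α : Form E M k} (hβ : β ∈ 𝓕.basicForms 1)
    (hα : α ∈ 𝓕.basicForms k) : wedgeForm β α ∈ 𝓕.basicForms (k + 1) := by
  refine 𝓕.mem_basicForms_of_isBasicAt fun x₀ y π hy hπ => ?_
  have h : localRep (wedgeForm β α) x₀ =
      fun z => wedgeOne (localRep β x₀ z) (localRep α x₀ z) := by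
    funext z
    exact localRep_wedgeOne β α x₀ z
  rw [h]
  exact (isBasicAt_localRep hβ hy hπ).wedgeOne (isBasicAt_localRep hα hy hπ)

theorem lichD_mem_basicForms {θ : Form E M 1} {α : Form E M k} (hθ : θ ∈ 𝓕.basicForms 1)
    (hα : α ∈ 𝓕.basicForms k) : lichD θ α ∈ 𝓕.basicForms (k + 1) := by
  rw [lichD_eq]
  refine sub_mem ⟨hα.1.extD, hα.2.2, fun _ _ _ _ => ?_⟩ (wedgeForm_mem_basicForms hθ hα)
  rw [extD_extD hα.1]
  rfl

/-- Integrability of the transverse complex structure: at each point, `d_θ` of a basic form of type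
`(p, q)` is the pullback of the sum of a form of type `(p + 1, q)` and one of type `(p, q + 1)`. -/
theorem exists_lichD_eq_comp {θ : Form E M 1} {α : Form E M k} (hθ : θ ∈ 𝓕.basicForms 1) {p q : ℕ}
    (hpq : p + q = k) (hα : α ∈ 𝓕.basicFormsOfType k p q) (x : M) :
    ∃ (L : E →L[ℝ] EuclideanSpace ℂ (Fin n))
      (β γ : EuclideanSpace ℂ (Fin n) [⋀^Fin (k + 1)]→L[ℝ] ℂ),
      (∀ v, L (𝓕.J x v) = mulI _ (L v)) ∧ HasType (p + 1) q β ∧ HasType p (q + 1) γ ∧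
      lichD θ α x = (β + γ).compContinuousLinearMap L := by
  set y := extChartAt 𝓘(ℝ, E) x x with hydef
  have hy : y ∈ (extChartAt 𝓘(ℝ, E) x).target := mem_extChartAt_target x
  have hyx : (extChartAt 𝓘(ℝ, E) x).symm y = x :=
    (extChartAt 𝓘(ℝ, E) x).left_inv (mem_extChartAt_source (I := 𝓘(ℝ, E)) x)
  obtain ⟨π, hπ⟩ := 𝓕.exists_isLocalSubmersion hy
  obtain ⟨a₀, ha₀, hαa₀, hk₀⟩ := isBasicAt_localRep hα.1 hy hπ
  obtain ⟨b, -, hθb, -⟩ := isBasicAt_localRep hθ hy hπ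
  -- The coefficients may be taken of type `(p, q)` at all points.
  let Q := LinearMap.toContinuousLinearMap
    ((hodgePart (k := k) (mulI (EuclideanSpace ℂ (Fin n))) p q).restrictScalars ℝ)
  let a : E → EuclideanSpace ℂ (Fin n) [⋀^Fin k]→L[ℝ] ℂ := fun z => Q (a₀ z)
  have ha : ContDiffAt ℝ ∞ a y := Q.contDiff.contDiffAt.comp y ha₀
  have hαa : ∀ᶠ z in 𝓝 y, localRep α x z = (a z).compContinuousLinearMap (fderiv ℝ π z) := by
    have h := hπ.eventually_localRep_typePart hy p q α
    rw [hα.2] at h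
    filter_upwards [hαa₀, h] with z hz hz'
    exact hz' _ hz
  have hfd : fderiv ℝ a y = Q ∘L fderiv ℝ a₀ y :=
    (Q.hasFDerivAt.comp y (ha₀.differentiableAt (by simp)).hasFDerivAt).fderiv
  have hker : ∀ u, fderiv ℝ π y u = 0 → fderiv ℝ a y u = 0 := fun u hu => by
    rw [hfd, ContinuousLinearMap.comp_apply, hk₀ u hu, map_zero]
  obtain ⟨s, hs⟩ := ContinuousLinearMap.exists_rightInverse_of_surjective (fderiv ℝ π y)
    (LinearMap.range_eq_top.mpr (hπ.surjective hy))
  have hd := extDeriv_eq_of_model hπ.1 (r := s) (fun w => congrArg (fun L => L w) hs) ha hαa hker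
  -- The term `θ ∧ α` is an antisymmetrisation too, and is absorbed in the linear map `B`.
  let B : EuclideanSpace ℂ (Fin n) →L[ℝ] EuclideanSpace ℂ (Fin n) [⋀^Fin k]→L[ℝ] ℂ :=
    fderiv ℝ a y ∘L s - ((ContinuousAlternatingMap.ofSubsingleton ℝ (EuclideanSpace ℂ (Fin n)) ℂ
      (0 : Fin 1)).symm (b y)).smulRight (a y)
  have hB : ∀ w, HasType p q (B w) := by
    intro w z v
    have h1 : HasType p q (fderiv ℝ a y (s w)) := by
      rw [hfd]
      exact hasType_hodgePart hpq _
    have h2 : HasType p q (a y) := hasType_hodgePart hpq _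
    simp only [B, sub_apply, ContinuousLinearMap.comp_apply,
      ContinuousAlternatingMap.sub_apply, ContinuousLinearMap.smulRight_apply,
      ContinuousAlternatingMap.smul_apply, smul_eq_mul, h1 z v, h2 z v]
    ring
  obtain ⟨β, γ, hβ, hγ, hsum⟩ := exists_hasType_add_eq_alternatizeUncurryFin hB
  have hBsub : ContinuousAlternatingMap.alternatizeUncurryFin B =
      ContinuousAlternatingMap.alternatizeUncurryFin (fderiv ℝ a y ∘L s) -
        wedgeOne (b y) (a y) :=
    map_sub (ContinuousAlternatingMap.alternatizeUncurryFinCLM ℝ (EuclideanSpace ℂ (Fin n)) ℂ) _ _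
  have hcomp := chartSymmD_comp_chartD hy
  rw [hyx] at hcomp
  have hcomp' : ∀ v, chartSymmD x y (chartD E x x v) = v := fun v =>
    congrArg (fun L : E →L[ℝ] E => L v) hcomp
  refine ⟨fderiv ℝ π y ∘L chartD E x x, β, γ, fun v => ?_, hβ, hγ, ?_⟩
  · have h1 : chartSymmD x y (chartD E x x (𝓕.J x v)) =
        𝓕.J ((extChartAt 𝓘(ℝ, E) x).symm y) (chartSymmD x y (chartD E x x v)) := by
      rw [hcomp', hcomp', hyx]
    exact hπ.eventually_intertwines.self_of_nhds _ _ h1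
  · have h1 : lichD θ α x = (extDeriv (localRep α x) y).compContinuousLinearMap (chartD E x x) -
        wedgeOne (θ x) (α x) := rfl
    rw [h1, apply_eq_localRep θ (mem_extChartAt_source (I := 𝓘(ℝ, E)) x),
      apply_eq_localRep α (mem_extChartAt_source (I := 𝓘(ℝ, E)) x), ← hydef, hd,
      hαa.self_of_nhds, hθb.self_of_nhds, wedgeOne_compContinuousLinearMap,
      wedgeOne_compContinuousLinearMap, ← hsum, hBsub]
    rfl

theorem lichD_eq_typePart_add {θ : Form E M 1} {α : Form E M k} (hθ : θ ∈ 𝓕.basicForms 1)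
    {p q : ℕ} (hpq : p + q = k) (hα : α ∈ 𝓕.basicFormsOfType k p q) :
    lichD θ α = 𝓕.typePart (p + 1) q (lichD θ α) + 𝓕.typePart p (q + 1) (lichD θ α) := by
  funext x
  obtain ⟨L, β, γ, hL, hβ, hγ, h⟩ := exists_lichD_eq_comp hθ hpq hα x
  show _ = 𝓕.typePart (p + 1) q (lichD θ α) x + 𝓕.typePart p (q + 1) (lichD θ α) x
  rw [typePart_apply, typePart_apply, h, hodgePart_compContinuousLinearMap L hL,
    hodgePart_compContinuousLinearMap L hL, map_add, map_add, hβ.hodgePart_self (by omega),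
    hγ.hodgePart_eq_zero (by omega) (by omega), hβ.hodgePart_eq_zero (by omega) (by omega),
    hγ.hodgePart_self (by omega), add_zero, zero_add]
  rfl

theorem typePart_lichD_eq_zero {θ : Form E M 1} {α : Form E M k} (hθ : θ ∈ 𝓕.basicForms 1)
    {p q p' q' : ℕ} (hpq : p + q = k) (hα : α ∈ 𝓕.basicFormsOfType k p q)
    (h1 : p' ≠ p + 1) (h2 : p' ≠ p) : 𝓕.typePart p' q' (lichD θ α) = 0 := by
  funext x
  obtain ⟨L, β, γ, hL, hβ, hγ, h⟩ := exists_lichD_eq_comp hθ hpq hα x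
  rw [typePart_apply, h, hodgePart_compContinuousLinearMap L hL, map_add,
    hβ.hodgePart_eq_zero (by omega) h1, hγ.hodgePart_eq_zero (by omega) h2, add_zero]
  rfl

end Foliation

/-! ### The Lee form -/

namespace Foliation

variable {E : Type*} [NormedAddCommGroup E] [NormedSpace ℝ E]
  {M : Type*} [TopologicalSpace M] [ChartedSpace E M] {n : ℕ}
  {T : Type*} [TopologicalSpace T] [ChartedSpace (EuclideanSpace ℂ (Fin n)) T]
  {ι : Type*} {𝓕 : Foliation E M n T ι} {ω₀ : Form E M 2} {θ : Form E M 1}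

theorem IsTransversallyLCK.conjForm_leeForm (h : 𝓕.IsTransversallyLCK ω₀ θ) :
    conjForm θ = θ := by
  funext x
  ext v
  obtain ⟨U, -, hx, σ, -, -, hθ, -⟩ := h.exists_potential x
  have hv : v = ![v 0] := by
    funext j
    fin_cases j
    rfl
  show (starRingEnd ℂ) (θ x v) = θ x v
  rw [hv, hθ x hx]
  exact Complex.conj_ofReal _

section

variable [IsManifold 𝓘(ℝ, E) ∞ M]

/-- Locally, the Lee form is the differential of the function `σ`. -/
theorem IsTransversallyLCK.exists_localRep_eq_extDeriv (h : 𝓕.IsTransversallyLCK ω₀ θ) {x₀ : M}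
    {y : E} (hy : y ∈ (extChartAt 𝓘(ℝ, E) x₀).target) :
    ∃ g : E → E [⋀^Fin 0]→L[ℝ] ℂ, ContDiffAt ℝ ∞ g y ∧
      localRep θ x₀ =ᶠ[𝓝 y] extDeriv g := by
  obtain ⟨U, hU, hx, σ, hσ, -, hθ, -⟩ :=
    h.exists_potential ((extChartAt 𝓘(ℝ, E) x₀).symm y)
  have htarget := (isOpen_extChartAt_target (I := 𝓘(ℝ, E)) x₀).mem_nhds hy
  have hcont : ContinuousAt (extChartAt 𝓘(ℝ, E) x₀).symm y := continuousAt_extChartAt_symm'' hy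
  have hs : ∀ z ∈ (extChartAt 𝓘(ℝ, E) x₀).target, (extChartAt 𝓘(ℝ, E) x₀).symm z ∈ U →
      ContDiffAt ℝ ∞ (σ ∘ (extChartAt 𝓘(ℝ, E) x₀).symm) z := by
    intro z hz hzU
    rw [← contMDiffAt_iff_contDiffAt]
    exact (hσ.contMDiffAt (hU.mem_nhds hzU)).comp z
      ((contMDiffOn_extChartAt_symm x₀).contMDiffAt
        ((isOpen_extChartAt_target (I := 𝓘(ℝ, E)) x₀).mem_nhds hz))
  refine ⟨fun z => ContinuousAlternatingMap.constOfIsEmpty ℝ E (Fin 0)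
    (((σ ∘ (extChartAt 𝓘(ℝ, E) x₀).symm) z : ℝ) : ℂ), ?_, ?_⟩
  · exact (ContinuousAlternatingMap.constOfIsEmptyLIE ℝ E ℂ (Fin 0)).contDiff.contDiffAt.comp y
      (Complex.ofRealCLM.contDiff.contDiffAt.comp y (hs y hy hx))
  · filter_upwards [htarget, hcont.eventually_mem (hU.mem_nhds hx)] with z hz hzU
    rw [extDeriv_constOfIsEmpty]
    have hσz : MDifferentiableAt 𝓘(ℝ, E) 𝓘(ℝ, ℝ) σ ((extChartAt 𝓘(ℝ, E) x₀).symm z) :=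
      (hσ.contMDiffAt (hU.mem_nhds hzU)).mdifferentiableAt (by simp)
    let D : E →L[ℝ] ℝ := mfderiv 𝓘(ℝ, E) 𝓘(ℝ, ℝ) σ ((extChartAt 𝓘(ℝ, E) x₀).symm z)
    have h1 : HasFDerivAt (σ ∘ (extChartAt 𝓘(ℝ, E) x₀).symm) (D ∘L chartSymmD x₀ z) z :=
      (hσz.hasMFDerivAt.comp z (hasMFDerivAt_extChartAt_symm hz)).hasFDerivAt
    have h2 : fderiv ℝ (fun z => (((σ ∘ (extChartAt 𝓘(ℝ, E) x₀).symm) z : ℝ) : ℂ)) z =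
        Complex.ofRealCLM ∘L D ∘L chartSymmD x₀ z :=
      (Complex.ofRealCLM.hasFDerivAt.comp z h1).fderiv
    rw [h2]
    ext v
    have hv : (fun r => chartSymmD x₀ z (v r)) = ![chartSymmD x₀ z (v 0)] := by
      funext j
      fin_cases j
      rfl
    show θ _ (fun r => chartSymmD x₀ z (v r)) = _
    rw [hv, hθ _ hzU]
    rfl

theorem IsTransversallyLCK.isSmoothForm_leeForm [FiniteDimensional ℝ E]
    (h : 𝓕.IsTransversallyLCK ω₀ θ) : IsSmoothForm θ := fun x₀ y hy => by
  obtain ⟨g, hg, hθ⟩ := h.exists_localRep_eq_extDeriv hy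
  refine (ContDiffAt.congr_of_eventuallyEq ?_ hθ).contDiffWithinAt
  exact (ContinuousAlternatingMap.alternatizeUncurryFinCLM ℝ E ℂ).contDiff.contDiffAt.comp y
    (ContDiffAt.fderiv_infty hg)

theorem IsTransversallyLCK.extD_leeForm (h : 𝓕.IsTransversallyLCK ω₀ θ) : extD θ = 0 := by
  funext x
  obtain ⟨g, hg, hθ⟩ := h.exists_localRep_eq_extDeriv (mem_extChartAt_target (I := 𝓘(ℝ, E)) x)
  rw [extD_eq, hθ.extDeriv_eq, extDeriv_extDeriv_apply hg minSmoothness_two_le_infty]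
  rfl

theorem IsTransversallyLCK.leeForm_mem_basicForms [FiniteDimensional ℝ E]
    (h : 𝓕.IsTransversallyLCK ω₀ θ) : θ ∈ 𝓕.basicForms 1 := by
  refine ⟨h.isSmoothForm_leeForm, fun x v r hr => ?_, fun x v r _ => ?_⟩
  · obtain ⟨U, -, hx, σ, -, hleaf, hθ, -⟩ := h.exists_potential x
    have hv : v = ![v r] := by
      funext j
      rw [Subsingleton.elim j 0, Subsingleton.elim r 0]
      rfl
    rw [hv, hθ x hx, hleaf x hx _ hr, Complex.ofReal_zero]
  · rw [h.extD_leeForm]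
    rfl

end

/-! ### Vanishing of cohomology -/

section Cohomology

theorem exists_lichD_eq (hLich : Subsingleton (𝓕.LichnerowiczCohomology θ 2)) {φ : Form E M 2}
    (hφ : φ ∈ 𝓕.basicForms 2) (hd : lichD θ φ = 0) :
    ∃ α ∈ 𝓕.basicForms 1, lichD θ α = φ := by
  have h := Submodule.Quotient.subsingleton_iff.mp hLich
  have hmem : (⟨⟨φ, hφ⟩, hd⟩ : LinearMap.ker (𝓕.dθ θ 2)) ∈
      ((𝓕.lichExact θ 2).comap (𝓕.basicForms 2).subtype).submoduleOf
        (LinearMap.ker (𝓕.dθ θ 2)) := by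
    rw [h]
    trivial
  obtain ⟨α, hα⟩ := hmem
  exact ⟨α.1, α.2, hα⟩

theorem exists_typePart_lichD_eq (hHol : Subsingleton (𝓕.HolomorphicCohomology θ 1))
    {α : Form E M 1} (hα : α ∈ 𝓕.basicFormsOfType 1 0 1)
    (hd : 𝓕.typePart 0 2 (lichD θ α) = 0) :
    ∃ f ∈ 𝓕.basicFormsOfType 0 0 0, 𝓕.typePart 0 1 (lichD θ f) = α := by
  have h := Submodule.Quotient.subsingleton_iff.mp hHol
  have hmem : (⟨⟨α, hα⟩, hd⟩ : LinearMap.ker (𝓕.delbarE θ 1 0 1)) ∈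
      ((𝓕.holExact θ 1).comap (𝓕.basicFormsOfType 1 0 1).subtype).submoduleOf
        (LinearMap.ker (𝓕.delbarE θ 1 0 1)) := by
    rw [h]
    trivial
  obtain ⟨f, hf⟩ := hmem
  exact ⟨f.1, f.2, hf⟩

variable [FiniteDimensional ℝ E] [IsManifold 𝓘(ℝ, E) ∞ M]
  [IsManifold 𝓘(ℂ, EuclideanSpace ℂ (Fin n)) ω T]

/-- On functions, `∂ ∂̄ + ∂̄ ∂ = 0` for the components of `d_θ`, when `θ` is closed. -/
theorem typePart_lichD_typePart_lichD (hθ : θ ∈ 𝓕.basicForms 1) (hd : extD θ = 0)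
    {f : Form E M 0} (hf : f ∈ 𝓕.basicForms 0) :
    𝓕.typePart 1 1 (lichD θ (𝓕.typePart 1 0 (lichD θ f))) =
      -𝓕.typePart 1 1 (lichD θ (𝓕.typePart 0 1 (lichD θ f))) := by
  have hdf := lichD_mem_basicForms hθ hf
  have h := lichD_lichD hθ.1 hd hf.1
  rw [← typePart_one_add (𝓕 := 𝓕) (lichD θ f), lichD_add θ (typePart_mem_basicForms hdf 1 0).1
    (typePart_mem_basicForms hdf 0 1).1] at h
  rw [eq_neg_iff_add_eq_zero, ← map_add, h, map_zero]

/-- Every `d_θ`-closed basic form of type `(1, 1)` is of the form `∂ ∂̄ f`. -/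
theorem exists_delE_delbarE_eq (hθ : θ ∈ 𝓕.basicForms 1) (hd : extD θ = 0)
    (hreal : conjForm θ = θ) (hHol : Subsingleton (𝓕.HolomorphicCohomology θ 1))
    (hLich : Subsingleton (𝓕.LichnerowiczCohomology θ 2)) {φ : Form E M 2}
    (hφ : φ ∈ 𝓕.basicFormsOfType 2 1 1) (hφd : lichD θ φ = 0) :
    ∃ f ∈ 𝓕.basicFormsOfType 0 0 0,
      𝓕.typePart 1 1 (lichD θ (𝓕.typePart 0 1 (lichD θ f))) = φ := by
  obtain ⟨α, hα, hαφ⟩ := exists_lichD_eq hLich hφ.1 hφd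
  have h10 := typePart_mem_basicFormsOfType hα (p := 1) (q := 0) rfl
  have h01 := typePart_mem_basicFormsOfType hα (p := 0) (q := 1) rfl
  set α' := 𝓕.typePart 1 0 α with hα'
  set α'' := 𝓕.typePart 0 1 α with hα''
  have hsum : lichD θ α' + lichD θ α'' = φ := by
    rw [← lichD_add θ h10.1.1 h01.1.1, hα', hα'', typePart_one_add, hαφ]
  -- Compare the components of type `(0, 2)` and `(2, 0)` of `φ = d_θ α' + d_θ α''`.
  have h02 : 𝓕.typePart 0 2 (lichD θ α'') = 0 := by
    have h : 𝓕.typePart 0 2 (lichD θ α' + lichD θ α'') = 𝓕.typePart 0 2 φ := by rw [hsum]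
    have h1 : 𝓕.typePart 0 2 (lichD θ α') = 0 :=
      typePart_lichD_eq_zero hθ rfl h10 (by omega) (by omega)
    have h2 : 𝓕.typePart 0 2 φ = 0 := typePart_eq_zero_of_ne hφ.1.2.1 rfl hφ.2 (by omega)
    rwa [map_add, h1, h2, zero_add] at h
  have h20 : 𝓕.typePart 2 0 (lichD θ α') = 0 := by
    have h : 𝓕.typePart 2 0 (lichD θ α' + lichD θ α'') = 𝓕.typePart 2 0 φ := by rw [hsum]
    have h1 : 𝓕.typePart 2 0 (lichD θ α'') = 0 :=
      typePart_lichD_eq_zero hθ rfl h01 (by omega) (by omega)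
    have h2 : 𝓕.typePart 2 0 φ = 0 := typePart_eq_zero_of_ne hφ.1.2.1 rfl hφ.2 (by omega)
    rwa [map_add, h1, h2, add_zero] at h
  obtain ⟨f, hf, hfα⟩ := exists_typePart_lichD_eq hHol h01 h02
  have hconj : 𝓕.typePart 0 2 (lichD θ (conjForm α')) = 0 := by
    rw [lichD_conjForm hreal h10.1.1, typePart_conjForm, h20, conjForm_zero]
  obtain ⟨g, hg, hgα⟩ := exists_typePart_lichD_eq hHol (conjForm_mem_basicFormsOfType h10) hconj
  have hgc := conjForm_mem_basicFormsOfType hg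
  have hgα' : 𝓕.typePart 1 0 (lichD θ (conjForm g)) = α' := by
    rw [lichD_conjForm hreal hg.1.1, typePart_conjForm, hgα, conjForm_conjForm]
  have h11 : 𝓕.typePart 1 1 (lichD θ α') + 𝓕.typePart 1 1 (lichD θ α'') = φ := by
    rw [← map_add, hsum]
    exact hφ.2
  refine ⟨f - conjForm g, sub_mem hf hgc, ?_⟩
  have hdf := typePart_mem_basicForms (lichD_mem_basicForms hθ hf.1) 0 1
  have hdg := typePart_mem_basicForms (lichD_mem_basicForms hθ hgc.1) 0 1
  rw [lichD_sub θ hf.1.1 hgc.1.1, map_sub, lichD_sub θ hdf.1 hdg.1, map_sub, sub_eq_add_neg,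
    ← typePart_lichD_typePart_lichD hθ hd hgc.1, hfα, hgα']
  exact (add_comm _ _).trans h11

end Cohomology

end Foliation

end TransLCK

end

theorem mainTheorem4
    {E : Type*} [NormedAddCommGroup E] [NormedSpace ℝ E] [FiniteDimensional ℝ E]
    {M : Type*} [TopologicalSpace M] [T2Space M] [SecondCountableTopology M] [ConnectedSpace M]
    [ChartedSpace E M] [IsManifold 𝓘(ℝ, E) ∞ M]
    {n : ℕ} {T : Type*} [TopologicalSpace T] [ChartedSpace (EuclideanSpace ℂ (Fin n)) T]
    [IsManifold 𝓘(ℂ, EuclideanSpace ℂ (Fin n)) ω T]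
    {ι : Type*} (𝓕 : TransLCK.Foliation E M n T ι)
    (ω₀ : TransLCK.Form E M 2) (θ : TransLCK.Form E M 1)
    (hLCK : 𝓕.IsTransversallyLCK ω₀ θ)
    (hHol : Subsingleton (𝓕.HolomorphicCohomology θ 1))
    (hLich : Subsingleton (𝓕.LichnerowiczCohomology θ 2)) :
    Subsingleton (𝓕.BottChernCohomology θ 1 1) := by
  open TransLCK Foliation in
  have hθ := hLCK.leeForm_mem_basicForms
  rw [Submodule.Quotient.subsingleton_iff, eq_top_iff]
  rintro ⟨⟨φ, hφ⟩, hdel, hdelbar⟩ -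
  have h1 : 𝓕.typePart 2 1 (lichD θ φ) = 0 := hdel
  have h2 : 𝓕.typePart 1 2 (lichD θ φ) = 0 := hdelbar
  have hφd : lichD θ φ = 0 := by
    rw [lichD_eq_typePart_add hθ rfl hφ, h1, h2, add_zero]
  obtain ⟨f, hf, hfφ⟩ := exists_delE_delbarE_eq hθ hLCK.extD_leeForm hLCK.conjForm_leeForm
    hHol hLich hφ hφd
  exact ⟨⟨𝓕.typePart 0 1 (lichD θ f),
    typePart_mem_basicFormsOfType (lichD_mem_basicForms hθ hf.1) rfl⟩, ⟨⟨f, hf⟩, rfl⟩, hfφ⟩
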